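/- Let $-\infty<a<b<\infty$ and let $f$ be a probability density on $\mathbb{R}$ with $f>0$ exactly on $(a,b)$ and $f\in C^3((a,b))$. Put $f_1(x):=f(a+x)$ and $f_2(x):=f(b-x)$, and assume that for $i=1,2$ there are constants $\kappa_i>0$ and $A_i$ such that, as $x\to+0$ (where $g\cong h$ means $g/h\to1$, and $g\cong 0$ is not allowed), - $f_i(x)\cong A_i x^{\kappa_i-1}$; - if $\kappa_i\neq1$: $f_i'(x)\cong A_i(\kappa_i-1)x^{\kappa_i-2}$; - if $\kappa_i\neq1,2$: $f_i''(x)\cong A_i(\kappa_i-1)(\kappa_i-2)x^{\kappa_i-3}$; - if $\kappa_i=2$: $x f_i''(x)\to0$; - if $\kappa_i=1$: the finite limits $\lim_{x\to+0}f_i'(x)$ and $\lim_{x\to+0}f_i''(x)$ exist. For $\theta\in\mathbb{R}$ let $f_\theta(x):=f(x-\theta)$; for $0<s<1$ let $I^s(p\|q):=-\log\int p^s(x)q^{1-s}(x)\,dx$; let $B(\cdot,\cdot)$ be the beta function and $J_f:=\int_a^b f^{-1}(x)(f'(x))^2\,dx$. If $\kappa:=\kappa_1=\kappa_2$, then for every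 $\theta$: - if $0<\kappa<1$: $$\lim_{\epsilon\to+0}\frac{I^s(f_\theta\|f_{\theta+\epsilon})}{\epsilon^\kappa}=\frac{1-\kappa}{\kappa}\bigl(A_1sB(s+\kappa(1-s),1-\kappa)+A_2(1-s)B(1-s+\kappa s,1-\kappa)\bigr);$$ - if $\kappa=1$: $$\lim_{\epsilon\to+0}\frac{I^s(f_\theta\|f_{\theta+\epsilon})}{\epsilon^\kappa}=A_1s+A_2(1-s);$$ - if $1<\kappa<2$: $$\lim_{\epsilon\to+0}\frac{I^s(f_\theta\|f_{\theta+\epsilon})}{\epsilon^\kappa}=\frac{A_1s(1-s(\kappa-1))B(s+\kappa(1-s),2-\kappa)}{\kappa}+\frac{A_2(1-s)(1-(1-s)(\kappa-1))B(1-s+\kappa s,2-\kappa)}{\kappa};$$ - if $\kappa=2$: $$\lim_{\epsilon\to+0}\frac{I^s(f_\theta\|f_{\theta+\epsilon})}{-\epsilon^2\log\epsilon}=\frac{(A_1+A_2)s(1-s)}{2};$$ - if $\kappa>2$: $J_f<\infty$ and $$\lim_{\epsilon\to+0}\frac{I^s(f_\theta\|f_{\theta+\epsilon})}{\epsilon^2}=\frac{s(1-s)}{2}J_f.$$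 In every case the convergence is uniform in $s\in(0,1)$. If instead $\kappa_1<\kappa_2$, the same statements hold with $\kappa:=\kappa_1$ and with $A_2$ replaced by $0$ in the formulas. -/

import Mathlib

open MeasureTheory Set Filter Topology Asymptotics

/-- The relative Rényi entropy `I^s(p‖q) = -log ∫ p^s q^(1-s)` of two densities on the line. -/
noncomputable def relRenyi (s : ℝ) (p q : ℝ → ℝ) : ℝ :=
  -Real.log (∫ x, p x ^ s * q x ^ (1 - s))

/-- The member `f_θ(x) = f(x - θ)` of the location-shift family generated by `f`. -/
def locShift (f : ℝ → ℝ) (θ : ℝ) : ℝ → ℝ := fun x => f (x - θ)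

/-- The integral `J_f = ∫_a^b f⁻¹ (f')²`. -/
noncomputable def fisherIntegral (f : ℝ → ℝ) (a b : ℝ) : ℝ :=
  ∫ x in Ioo a b, (f x)⁻¹ * deriv f x ^ 2

/-- `f` is a probability density on the line, positive exactly on `(a, b)` and of class `C³`
there. -/
structure IsC3DensityOn (f : ℝ → ℝ) (a b : ℝ) : Prop where
  nonneg : ∀ x, 0 ≤ f x
  support_eq : Function.support f = Ioo a b
  contDiffOn : ContDiffOn ℝ 3 f (Ioo a b)
  integrable : Integrable f
  integral_eq_one : ∫ x, f x = 1

/-- The behaviour `g(x) ≅ A x^(κ-1)` as `x → +0`, with the matching conditions on `g'` and `g''`.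
It is applied to `g(x) = f(a + x)` and to `g(x) = f(b - x)`. -/
structure EndpointBehavior (g : ℝ → ℝ) (κ A : ℝ) : Prop where
  pos : 0 < κ
  equiv_zero : g ~[𝓝[>] 0] fun x => A * x ^ (κ - 1)
  equiv_one : κ ≠ 1 → deriv g ~[𝓝[>] 0] fun x => A * (κ - 1) * x ^ (κ - 2)
  equiv_two : κ ≠ 1 → κ ≠ 2 →
    deriv (deriv g) ~[𝓝[>] 0] fun x => A * (κ - 1) * (κ - 2) * x ^ (κ - 3)
  tendsto_two : κ = 2 → Tendsto (fun x => x * deriv (deriv g) x) (𝓝[>] 0) (𝓝 0)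
  limits_one : κ = 1 → (∃ l, Tendsto (deriv g) (𝓝[>] 0) (𝓝 l)) ∧
    ∃ l, Tendsto (deriv (deriv g)) (𝓝[>] 0) (𝓝 l)

/-- The limiting behaviour, with parameters `κ`, `A₁`, `A₂`, of `I^s(f_θ‖f_{θ+ε})` as `ε → +0`,
uniformly in `0 < s < 1`. The beta function is `ProbabilityTheory.beta`. -/
def RenyiLimits (f : ℝ → ℝ) (a b κ A₁ A₂ θ : ℝ) : Prop :=
  (0 < κ → κ < 1 →
    TendstoUniformlyOn
      (fun ε s => relRenyi s (locShift f θ) (locShift f (θ + ε)) / ε ^ κ)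
      (fun s => (1 - κ) / κ *
        (A₁ * s * ProbabilityTheory.beta (s + κ * (1 - s)) (1 - κ) +
          A₂ * (1 - s) * ProbabilityTheory.beta (1 - s + κ * s) (1 - κ)))
      (𝓝[>] 0) (Ioo 0 1)) ∧
  (κ = 1 →
    TendstoUniformlyOn
      (fun ε s => relRenyi s (locShift f θ) (locShift f (θ + ε)) / ε ^ κ)
      (fun s => A₁ * s + A₂ * (1 - s))
      (𝓝[>] 0) (Ioo 0 1)) ∧
  (1 < κ → κ < 2 →
    TendstoUniformlyOn
      (fun ε s => relRenyi s (locShift f θ) (locShift f (θ + ε)) / ε ^ κ)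
      (fun s =>
        A₁ * s * (1 - s * (κ - 1)) *
          ProbabilityTheory.beta (s + κ * (1 - s)) (2 - κ) / κ +
        A₂ * (1 - s) * (1 - (1 - s) * (κ - 1)) *
          ProbabilityTheory.beta (1 - s + κ * s) (2 - κ) / κ)
      (𝓝[>] 0) (Ioo 0 1)) ∧
  (κ = 2 →
    TendstoUniformlyOn
      (fun ε s => relRenyi s (locShift f θ) (locShift f (θ + ε)) / (-ε ^ 2 * Real.log ε))
      (fun s => (A₁ + A₂) * s * (1 - s) / 2)
      (𝓝[>] 0) (Ioo 0 1)) ∧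
  (2 < κ →
    IntegrableOn (fun x => (f x)⁻¹ * deriv f x ^ 2) (Ioo a b) ∧
    TendstoUniformlyOn
      (fun ε s => relRenyi s (locShift f θ) (locShift f (θ + ε)) / ε ^ 2)
      (fun s => s * (1 - s) / 2 * fisherIntegral f a b)
      (𝓝[>] 0) (Ioo 0 1))

/-!
For densities `p`, `q` the integral of the weighted AM–GM defect
`s p + (1 - s) q - p ^ s q ^ (1 - s)` is `1 - ∫ p ^ s q ^ (1 - s)`, so `I ^ s` is equivalent to the
total defect between `f_θ` and `f_(θ + ε)`. Cutting the line at the middle of the supports splits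
this total into two edge contributions, which differ only by the reflection `s ↦ 1 - s`.

At an edge where `f ∼ A x ^ (κ - 1)` with `κ < 2`, rescaling by `ε` and dominated convergence give
`ε ^ κ` times the defect between `A x ^ (κ - 1)` and its unit translate, a beta integral. Away from
the edge, a second-order expansion in the log-ratio turns the defect into
`s (1 - s) / 2 * ε ^ 2 * f'² / f`. This is integrable up to the edge if `κ > 2`, and for `κ = 2` its
divergence like `A / x` is read off from the substitution `x = ε ^ τ`, which spreads `∫ dx / x` over
`0 < τ < 1` with total mass `-log ε`.

All these limits hold jointly in `(ε, s)` as `s` tends to any point of the compact interval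
`[0, 1]`, which yields uniformity on `(0, 1)`.
-/

/-- The defect of the weighted arithmetic-geometric mean inequality. -/
noncomputable def amgmGap (s p q : ℝ) : ℝ := s * p + (1 - s) * q - p ^ s * q ^ (1 - s)

section AmgmGap

variable {s p q : ℝ}

lemma amgmGap_nonneg (hs : s ∈ Icc (0 : ℝ) 1) (hp : 0 ≤ p) (hq : 0 ≤ q) : 0 ≤ amgmGap s p q :=
  sub_nonneg.2 <| Real.geom_mean_le_arith_mean2_weighted hs.1 (sub_nonneg.2 hs.2) hp hq (by ring)

lemma amgmGap_le_add (hs : s ∈ Icc (0 : ℝ) 1) (hp : 0 ≤ p) (hq : 0 ≤ q) :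
    amgmGap s p q ≤ p + q := by
  have hgeom : 0 ≤ p ^ s * q ^ (1 - s) := by positivity
  unfold amgmGap
  nlinarith [mul_nonneg (sub_nonneg.2 hs.2) hp, mul_nonneg hs.1 hq]

lemma amgmGap_one_sub_comm (s p q : ℝ) : amgmGap (1 - s) q p = amgmGap s p q := by
  unfold amgmGap
  rw [sub_sub_cancel]
  ring

lemma amgmGap_zero_right (hs : s ≠ 1) (p : ℝ) : amgmGap s p 0 = s * p := by
  rw [amgmGap, Real.zero_rpow (sub_ne_zero.2 hs.symm)]
  ring

lemma amgmGap_mul_left {c : ℝ} (hc : 0 < c) (hp : 0 ≤ p) (hq : 0 ≤ q) :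
    amgmGap s (c * p) (c * q) = c * amgmGap s p q := by
  have hpow : c ^ s * c ^ (1 - s) = c := by rw [← Real.rpow_add hc, add_sub_cancel, Real.rpow_one]
  unfold amgmGap
  rw [Real.mul_rpow hc.le hp, Real.mul_rpow hc.le hq]
  linear_combination (-p ^ s * q ^ (1 - s)) * hpow

lemma measurable_amgmGap {α : Type*} [MeasurableSpace α] {p q : α → ℝ} (s : ℝ)
    (hp : Measurable p) (hq : Measurable q) : Measurable fun x => amgmGap s (p x) (q x) := by
  unfold amgmGap
  fun_prop

lemma amgmGap_eq_mul_exp (s : ℝ) (hp : 0 < p) (hq : 0 < q) :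
    amgmGap s p q = p * (s + (1 - s) * Real.exp (Real.log q - Real.log p)
      - Real.exp ((1 - s) * (Real.log q - Real.log p))) := by
  have hlinear : p * Real.exp (Real.log q - Real.log p) = q := by
    rw [Real.exp_sub, Real.exp_log hp, Real.exp_log hq]
    field_simp
  have hgeom : p * Real.exp ((1 - s) * (Real.log q - Real.log p)) = p ^ s * q ^ (1 - s) := by
    nth_rw 1 [← Real.exp_log hp]
    rw [Real.rpow_def_of_pos hp, Real.rpow_def_of_pos hq, ← Real.exp_add, ← Real.exp_add]
    ring_nf
  unfold amgmGap
  linear_combination hgeom - (1 - s) * hlinear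

lemma abs_exp_sub_sum_le (v : ℝ) (n : ℕ) :
    |Real.exp v - ∑ m ∈ Finset.range n, v ^ m / m.factorial| ≤ |v| ^ n * Real.exp |v| := by
  simpa only [Complex.norm_real, Real.norm_eq_abs, ← Complex.ofReal_exp, ← Complex.ofReal_pow,
    ← Complex.ofReal_natCast, ← Complex.ofReal_div, ← Complex.ofReal_sum, ← Complex.ofReal_sub]
    using Complex.norm_exp_sub_sum_le_norm_mul_exp (v : ℂ) n

lemma amgmGap_le_mul_sq_log (hs : s ∈ Icc (0 : ℝ) 1) (hp : 0 < p) (hq : 0 < q) :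
    amgmGap s p q ≤ p * ((Real.log q - Real.log p) ^ 2 * Real.exp |Real.log q - Real.log p|) := by
  rw [amgmGap_eq_mul_exp s hp hq]
  set w := Real.log q - Real.log p
  have hquad : Real.exp w - 1 - w ≤ w ^ 2 * Real.exp |w| := by
    have := (abs_le.1 (abs_exp_sub_sum_le w 2)).2
    simp only [Finset.sum_range_succ, Finset.sum_range_zero, Nat.factorial, sq_abs] at this
    norm_num at this
    linarith
  have hexp : (1 - s) * w + 1 ≤ Real.exp ((1 - s) * w) := Real.add_one_le_exp _
  have hrem : 0 ≤ Real.exp w - 1 - w := by linarith [Real.add_one_le_exp w]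
  gcongr
  nlinarith [mul_nonneg hs.1 hrem]

lemma abs_amgmGap_sub_le (hs : s ∈ Icc (0 : ℝ) 1) (hp : 0 < p) (hq : 0 < q) :
    |amgmGap s p q - s * (1 - s) / 2 * (p * (Real.log q - Real.log p) ^ 2)| ≤
      2 * (p * (|Real.log q - Real.log p| ^ 3 * Real.exp |Real.log q - Real.log p|)) := by
  rw [amgmGap_eq_mul_exp s hp hq]
  set w := Real.log q - Real.log p
  have hcubic (v : ℝ) : |Real.exp v - (1 + v + v ^ 2 / 2)| ≤ |v| ^ 3 * Real.exp |v| := by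
    simpa [Finset.sum_range_succ, Nat.factorial] using abs_exp_sub_sum_le v 3
  have hs' : 0 ≤ 1 - s := sub_nonneg.2 hs.2
  have hle : |(1 - s) * w| ≤ |w| := by
    rw [abs_mul, abs_of_nonneg hs']
    exact mul_le_of_le_one_left (abs_nonneg w) (by linarith [hs.1])
  have hscaled := (hcubic ((1 - s) * w)).trans
    (mul_le_mul (pow_le_pow_left₀ (abs_nonneg _) hle 3) (Real.exp_le_exp.2 hle)
      (Real.exp_pos _).le (by positivity))
  have hw : |(1 - s) * (Real.exp w - (1 + w + w ^ 2 / 2))| ≤ |w| ^ 3 * Real.exp |w| := by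
    rw [abs_mul, abs_of_nonneg hs']
    exact (mul_le_of_le_one_left (abs_nonneg _) (by linarith [hs.1])).trans (hcubic w)
  calc _ = p * |(1 - s) * (Real.exp w - (1 + w + w ^ 2 / 2))
          - (Real.exp ((1 - s) * w) - (1 + (1 - s) * w + ((1 - s) * w) ^ 2 / 2))| := by
        rw [← abs_of_pos hp, ← abs_mul, abs_of_pos hp]
        ring_nf
    _ ≤ p * (|w| ^ 3 * Real.exp |w| + |w| ^ 3 * Real.exp |w|) := by
        gcongr
        exact (abs_sub _ _).trans (add_le_add hw hscaled)
    _ = _ := by ring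

end AmgmGap

section Limits

variable {ι : Type*} {l : Filter ι} {s p q : ι → ℝ} {s₀ p₀ q₀ : ℝ}

lemma tendsto_amgmGap (hs : Tendsto s l (𝓝 s₀)) (hp : Tendsto p l (𝓝 p₀))
    (hq : Tendsto q l (𝓝 q₀)) (hp₀ : p₀ ≠ 0) (hq₀ : q₀ ≠ 0) :
    Tendsto (fun i => amgmGap (s i) (p i) (q i)) l (𝓝 (amgmGap s₀ p₀ q₀)) :=
  ((hs.mul hp).add ((hs.const_sub 1).mul hq)).sub
    ((hp.rpow hs (.inl hp₀)).mul (hq.rpow (hs.const_sub 1) (.inl hq₀)))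

lemma tendsto_amgmGap_zero (hs : ∀ᶠ i in l, s i ∈ Icc (0 : ℝ) 1) (hp : Tendsto p l (𝓝 0))
    (hq : Tendsto q l (𝓝 0)) (hp₀ : ∀ᶠ i in l, 0 ≤ p i) (hq₀ : ∀ᶠ i in l, 0 ≤ q i) :
    Tendsto (fun i => amgmGap (s i) (p i) (q i)) l (𝓝 0) := by
  refine tendsto_of_tendsto_of_tendsto_of_le_of_le' tendsto_const_nhds
    (by simpa only [add_zero] using hp.add hq) ?_ ?_
  · filter_upwards [hs, hp₀, hq₀] with i hsi hpi hqi using amgmGap_nonneg hsi hpi hqi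
  · filter_upwards [hs, hp₀, hq₀] with i hsi hpi hqi using amgmGap_le_add hsi hpi hqi

lemma tendsto_mul_amgmGap {c : ι → ℝ} {J : ℝ} (hs : Tendsto s l (𝓝[Ioo 0 1] s₀))
    (hp : ∀ᶠ i in l, 0 < p i) (hq : ∀ᶠ i in l, 0 < q i)
    (hlog : Tendsto (fun i => Real.log (q i) - Real.log (p i)) l (𝓝 0))
    (hJ : Tendsto (fun i => c i * (p i * (Real.log (q i) - Real.log (p i)) ^ 2)) l (𝓝 J)) :
    Tendsto (fun i => c i * amgmGap (s i) (p i) (q i)) l (𝓝 (s₀ * (1 - s₀) / 2 * J)) := by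
  have hs' := tendsto_nhds_of_tendsto_nhdsWithin hs
  set w := fun i => Real.log (q i) - Real.log (p i)
  have herror : Tendsto (fun i => 2 * (|c i * (p i * w i ^ 2)| * (|w i| * Real.exp |w i|)))
      l (𝓝 0) := by
    simpa using (hJ.abs.mul (hlog.abs.mul (Real.continuous_exp.tendsto _ |>.comp hlog.abs)))
      |>.const_mul 2
  have hmain : Tendsto (fun i => s i * (1 - s i) / 2 * (c i * (p i * w i ^ 2))) l
      (𝓝 (s₀ * (1 - s₀) / 2 * J)) := ((hs'.mul (hs'.const_sub 1)).div_const 2).mul hJ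
  refine tendsto_of_tendsto_of_dist hmain
    (squeeze_zero' (.of_forall fun _ => dist_nonneg) ?_ herror)
  filter_upwards [tendsto_nhdsWithin_iff.1 hs |>.2, hp, hq] with i hsi hpi hqi
  calc _ = |c i| * |amgmGap (s i) (p i) (q i) - s i * (1 - s i) / 2 * (p i * w i ^ 2)| := by
        rw [← abs_mul, dist_comm, Real.dist_eq]
        ring_nf
    _ ≤ |c i| * (2 * (p i * (|w i| ^ 3 * Real.exp |w i|))) := by
        gcongr
        exact abs_amgmGap_sub_le (Ioo_subset_Icc_self hsi) hpi hqi
    _ = _ := by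
        rw [abs_mul, abs_mul, abs_of_pos hpi, abs_pow]
        ring

lemma isEquivalent_neg_log_one_sub : (fun t : ℝ => -Real.log (1 - t)) ~[𝓝 0] id := by
  have hderiv : HasDerivAt (fun t : ℝ => -Real.log (1 - t)) 1 0 := by
    simpa using! (((hasDerivAt_id (0 : ℝ)).const_sub 1).log (by simp)).neg
  simpa [IsEquivalent, hasDerivAt_iff_isLittleO, Pi.sub_def, Function.id_def] using hderiv

lemma tendsto_neg_log_one_sub_div {D w : ι → ℝ} {c : ℝ}
    (hD : Tendsto (fun i => D i / w i) l (𝓝 c)) (hw : Tendsto w l (𝓝 0))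
    (hw₀ : ∀ᶠ i in l, w i ≠ 0) :
    Tendsto (fun i => -Real.log (1 - D i) / w i) l (𝓝 c) := by
  have hD₀ : Tendsto D l (𝓝 0) := by
    refine (mul_zero c ▸ hD.mul hw).congr' ?_
    filter_upwards [hw₀] with i hi using div_mul_cancel₀ _ hi
  exact ((isEquivalent_neg_log_one_sub.comp_tendsto hD₀).div .refl).symm.tendsto_nhds hD

lemma tendstoUniformlyOn_of_isCompact_of_subset {X Y : Type*} [TopologicalSpace X]
    [PseudoMetricSpace Y] [l.NeBot] {F : ι → X → Y} {G : X → Y} {K S : Set X} (hK : IsCompact K)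
    (hS : S ⊆ K) (hF : ∀ x ∈ K, Tendsto (fun z : ι × X => F z.1 z.2) (l ×ˢ 𝓝[S] x) (𝓝 (G x))) :
    TendstoUniformlyOn F G l S := by
  have hpointwise : ∀ x ∈ S, Tendsto (F · x) l (𝓝 (G x)) := fun x hx =>
    (hF x (hS hx)).comp <| tendsto_id.prodMk <|
      tendsto_const_pure.mono_right (pure_le_nhdsWithin hx)
  refine Metric.tendstoUniformlyOn_iff.2 fun e he => ?_
  have hlocal : ∀ x ∈ K, {z : ι × X | z.2 ∈ S → dist (G z.2) (F z.1 z.2) < e} ∈ l ×ˢ 𝓝 x := by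
    intro x hx
    obtain ⟨t, ht, V, hV, htV⟩ := mem_prod_iff.1 (hF x hx (Metric.ball_mem_nhds _ (half_pos he)))
    refine mem_of_superset (prod_mem_prod ht (mem_nhdsWithin_iff_eventually.1 hV))
      fun ⟨i, y⟩ ⟨hi, hyV⟩ hyS => ?_
    have hG : dist (G y) (G x) ≤ e / 2 :=
      le_of_tendsto ((hpointwise y hyS).dist tendsto_const_nhds) <|
        mem_of_superset ht fun j hj => (htV (⟨hj, hyV hyS⟩ : (j, y) ∈ t ×ˢ V)).le (α := ℝ)
    have hFi : dist (F i y) (G x) < e / 2 := htV (⟨hi, hyV hyS⟩ : (i, y) ∈ t ×ˢ V)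
    linarith [dist_triangle_right (G y) (F i y) (G x)]
  obtain ⟨t, ht, U, hU, htU⟩ := mem_prod_iff.1 (hK.mem_prod_nhdsSet_of_forall hlocal)
  filter_upwards [ht] with i hi x hx using
    htU (⟨hi, subset_of_mem_nhdsSet hU (hS hx)⟩ : (i, x) ∈ t ×ˢ U) hx

end Limits

lemma relRenyi_eq_neg_log_one_sub {s : ℝ} {p q : ℝ → ℝ} (hs : s ∈ Icc (0 : ℝ) 1)
    (hp : Integrable p) (hq : Integrable q) (hp₀ : 0 ≤ p) (hq₀ : 0 ≤ q)
    (hp₁ : ∫ x, p x = 1) (hq₁ : ∫ x, q x = 1) :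
    relRenyi s p q = -Real.log (1 - ∫ x, amgmGap s (p x) (q x)) := by
  have hmean : Integrable fun x => s * p x + (1 - s) * q x :=
    (hp.const_mul s).add (hq.const_mul (1 - s))
  have hgeom : Integrable fun x => p x ^ s * q x ^ (1 - s) := by
    refine hmean.mono' ((hp.aemeasurable.pow_const s).mul
      (hq.aemeasurable.pow_const (1 - s))).aestronglyMeasurable (.of_forall fun x => ?_)
    rw [Real.norm_of_nonneg
      (mul_nonneg (Real.rpow_nonneg (hp₀ x) _) (Real.rpow_nonneg (hq₀ x) _))]
    exact sub_nonneg.1 (amgmGap_nonneg hs (hp₀ x) (hq₀ x))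
  have hgap : ∫ x, amgmGap s (p x) (q x) = 1 - ∫ x, p x ^ s * q x ^ (1 - s) := by
    unfold amgmGap
    rw [integral_sub hmean hgeom, integral_add (hp.const_mul s) (hq.const_mul (1 - s)),
      integral_const_mul, integral_const_mul, hp₁, hq₁]
    ring
  rw [hgap, sub_sub_cancel, relRenyi]

/-- First-order regularity of `g` at `0+` with exponent `κ - 1` and leading coefficient `A`, which
may vanish. The logarithmic derivative is only controlled up to a constant, except in the critical
case `κ = 2`. -/
structure RegularEndpoint (g : ℝ → ℝ) (κ A : ℝ) : Prop where
  tendsto_div_rpow : Tendsto (fun x => g x / x ^ (κ - 1)) (𝓝[>] 0) (𝓝 A)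
  deriv_isBigO : deriv g =O[𝓝[>] 0] fun x => g x / x
  tendsto_deriv : κ = 2 → Tendsto (deriv g) (𝓝[>] 0) (𝓝 A)

lemma EndpointBehavior.coeff_ne_zero {g : ℝ → ℝ} {κ A : ℝ} (h : EndpointBehavior g κ A)
    (hg : ∀ᶠ x in 𝓝[>] 0, g x ≠ 0) : A ≠ 0 := by
  rintro rfl
  have hzero : g =ᶠ[𝓝[>] 0] 0 := by
    simpa only [zero_mul] using isEquivalent_zero_iff_eventually_zero.1
      (h.equiv_zero.congr_right (.of_forall fun x => zero_mul _))
  obtain ⟨x, hx, hx'⟩ := (hzero.and hg).exists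
  exact hx' hx

lemma EndpointBehavior.deriv_isBigO {g : ℝ → ℝ} {κ A : ℝ} (h : EndpointBehavior g κ A)
    (hA : A ≠ 0) : deriv g =O[𝓝[>] 0] fun x => g x / x := by
  have hdiv : (fun x => A * x ^ (κ - 2)) =O[𝓝[>] 0] fun x => g x / x := by
    refine ((h.equiv_zero.div .refl).symm.isBigO).congr' ?_ .rfl
    filter_upwards [self_mem_nhdsWithin] with x hx
    rw [Pi.div_apply, mul_div_assoc, ← Real.rpow_sub_one (ne_of_gt hx)]
    ring_nf
  rcases eq_or_ne κ 1 with rfl | hκ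
  · obtain ⟨⟨m, hm⟩, -⟩ := h.limits_one rfl
    refine (hm.isBigO_one ℝ).trans (.trans ?_ hdiv)
    refine .of_bound |A|⁻¹ ?_
    filter_upwards [Ioo_mem_nhdsGT one_pos] with x hx
    have hrpow : 1 ≤ x ^ (1 - 2 : ℝ) :=
      Real.one_le_rpow_of_pos_of_le_one_of_nonpos hx.1 hx.2.le (by norm_num)
    rw [norm_mul, Real.norm_of_nonneg (zero_le_one.trans hrpow), norm_one, Real.norm_eq_abs,
      inv_mul_cancel_left₀ (abs_ne_zero.2 hA)]
    exact hrpow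
  · refine .trans ((h.equiv_one hκ).isBigO.trans ?_) hdiv
    exact (isBigO_const_mul_self (κ - 1) (fun x => A * x ^ (κ - 2)) _).congr_left
      fun x => by ring

lemma EndpointBehavior.regularEndpoint {g : ℝ → ℝ} {κ A : ℝ} (h : EndpointBehavior g κ A)
    (hg : ∀ᶠ x in 𝓝[>] 0, g x ≠ 0) : RegularEndpoint g κ A where
  tendsto_div_rpow := by
    have hquot : (fun x => g x / x ^ (κ - 1)) ~[𝓝[>] 0] fun _ => A := by
      refine (h.equiv_zero.div .refl).congr_right ?_
      filter_upwards [self_mem_nhdsWithin] with x hx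
      exact mul_div_cancel_right₀ _ (Real.rpow_pos_of_pos hx _).ne'
    exact hquot.symm.tendsto_nhds tendsto_const_nhds
  deriv_isBigO := h.deriv_isBigO (h.coeff_ne_zero hg)
  tendsto_deriv := by
    rintro rfl
    have hderiv : deriv g ~[𝓝[>] 0] fun _ => A :=
      (h.equiv_one (by norm_num)).congr_right (.of_forall fun x => by norm_num)
    exact hderiv.symm.tendsto_nhds tendsto_const_nhds

lemma tendsto_rpow_nhdsGT_zero {p : ℝ} (hp : 0 < p) :
    Tendsto (fun x : ℝ => x ^ p) (𝓝[>] 0) (𝓝[>] 0) := by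
  refine tendsto_nhdsWithin_iff.2 ⟨?_, ?_⟩
  · simpa only [Real.zero_rpow hp.ne'] using
      ((Real.continuous_rpow_const hp.le).tendsto (0 : ℝ)).mono_left nhdsWithin_le_nhds
  · filter_upwards [self_mem_nhdsWithin] with x hx using Real.rpow_pos_of_pos hx p

lemma RegularEndpoint.isBigO_rpow {g : ℝ → ℝ} {κ A : ℝ} (h : RegularEndpoint g κ A) :
    g =O[𝓝[>] 0] fun x => x ^ (κ - 1) := by
  refine isBigO_of_div_tendsto_nhds ?_ A h.tendsto_div_rpow
  filter_upwards [self_mem_nhdsWithin] with x hx hx'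
  exact absurd hx' (Real.rpow_pos_of_pos hx _).ne'

lemma RegularEndpoint.of_lt {g : ℝ → ℝ} {κ κ' A : ℝ} (h : RegularEndpoint g κ' A) (hκ : κ < κ') :
    RegularEndpoint g κ 0 where
  tendsto_div_rpow := by
    have hlim := h.tendsto_div_rpow.mul
      (tendsto_nhds_of_tendsto_nhdsWithin (tendsto_rpow_nhdsGT_zero (sub_pos.2 hκ)))
    refine (mul_zero A ▸ hlim).congr' ?_
    filter_upwards [self_mem_nhdsWithin] with x (hx : 0 < x)
    rw [div_mul_eq_mul_div, div_eq_div_iff (by positivity) (by positivity), mul_assoc,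
      ← Real.rpow_add hx]
    ring_nf
  deriv_isBigO := h.deriv_isBigO
  tendsto_deriv := by
    rintro rfl
    have hpow : (fun x => g x / x) =O[𝓝[>] 0] fun x => x ^ (κ' - 2) := by
      refine (h.isBigO_rpow.mul (isBigO_refl (fun x : ℝ => x⁻¹) _)).congr' .rfl ?_
      filter_upwards [self_mem_nhdsWithin] with x hx
      rw [← div_eq_mul_inv, ← Real.rpow_sub_one (ne_of_gt hx)]
      ring_nf
    exact (h.deriv_isBigO.trans hpow).trans_tendsto
      (tendsto_nhds_of_tendsto_nhdsWithin (tendsto_rpow_nhdsGT_zero (sub_pos.2 hκ)))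

/-- A profile for the shape of a density near the left end `0` of its support, regular up to
`R`. -/
structure EdgeProfile (h : ℝ → ℝ) (R : ℝ) : Prop where
  measurable : Measurable h
  nonneg : ∀ u, 0 ≤ h u
  eq_zero : ∀ u ≤ 0, h u = 0
  pos : ∀ u ∈ Ioo 0 R, 0 < h u
  contDiffOn : ContDiffOn ℝ 1 h (Ioo 0 R)

/-- An edge profile of order `u ^ (κ - 1)` whose logarithmic derivative is of order `u⁻¹`, with
explicit constants so that the bounds survive rescaling. -/
structure EdgeBound (h : ℝ → ℝ) (κ C R : ℝ) : Prop extends EdgeProfile h R where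
  le_rpow : ∀ u ∈ Ioo 0 R, h u ≤ C * u ^ (κ - 1)
  abs_logDeriv_le : ∀ u ∈ Ioo 0 R, |logDeriv h u| ≤ C / u

lemma exists_abs_le_of_isBigO_one {g : ℝ → ℝ} {R : ℝ} (hg : ContinuousOn g (Ioc 0 R))
    (hg₀ : g =O[𝓝[>] 0] fun _ => (1 : ℝ)) : ∃ C, ∀ u ∈ Ioc 0 R, |g u| ≤ C := by
  obtain ⟨C₀, hC₀⟩ := hg₀.bound
  obtain ⟨δ, hδ, hnear⟩ := mem_nhdsGT_iff_exists_Ioo_subset.1 hC₀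
  obtain ⟨C₁, hfar⟩ := isCompact_Icc.exists_bound_of_continuousOn
    (hg.mono fun u (hu : u ∈ Icc δ R) => ⟨lt_of_lt_of_le hδ hu.1, hu.2⟩)
  refine ⟨max C₀ C₁, fun u hu => ?_⟩
  rcases lt_or_ge u δ with huδ | huδ
  · exact le_max_of_le_left (by simpa using hnear ⟨hu.1, huδ⟩)
  · exact le_max_of_le_right (hfar u ⟨huδ, hu.2⟩)

namespace EdgeProfile

variable {h : ℝ → ℝ} {R L u : ℝ}

lemma mono (hp : EdgeProfile h L) (hRL : R ≤ L) : EdgeProfile h R where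
  measurable := hp.measurable
  nonneg := hp.nonneg
  eq_zero := hp.eq_zero
  pos u hu := hp.pos u (Ioo_subset_Ioo_right hRL hu)
  contDiffOn := hp.contDiffOn.mono (Ioo_subset_Ioo_right hRL)

lemma differentiableAt (hp : EdgeProfile h R) (hu : u ∈ Ioo 0 R) : DifferentiableAt ℝ h u :=
  (hp.contDiffOn.differentiableOn one_ne_zero).differentiableAt (Ioo_mem_nhds hu.1 hu.2)

lemma eventually_ne_zero (hp : EdgeProfile h R) (hR : 0 < R) : ∀ᶠ x in 𝓝[>] 0, h x ≠ 0 :=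
  mem_of_superset (Ioo_mem_nhdsGT hR) fun x hx => (hp.pos x hx).ne'

lemma deriv_log (hp : EdgeProfile h R) (hu : u ∈ Ioo 0 R) :
    deriv (fun u => Real.log (h u)) u = logDeriv h u :=
  deriv.log (hp.differentiableAt hu) (hp.pos u hu).ne'

lemma continuousOn_logDeriv (hp : EdgeProfile h R) : ContinuousOn (logDeriv h) (Ioo 0 R) :=
  (hp.contDiffOn.continuousOn_deriv_of_isOpen isOpen_Ioo le_rfl).div hp.contDiffOn.continuousOn
    fun u hu => (hp.pos u hu).ne'

lemma exists_edgeBound {κ A : ℝ} (hp : EdgeProfile h L) (hreg : RegularEndpoint h κ A)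
    (hRL : R < L) : ∃ C, EdgeBound h κ C R := by
  have hsub : Ioc 0 R ⊆ Ioo 0 L := fun u hu => ⟨hu.1, hu.2.trans_lt hRL⟩
  obtain ⟨C₁, hC₁⟩ := exists_abs_le_of_isBigO_one
    (R := R) (g := fun u => h u / u ^ (κ - 1))
    ((hp.contDiffOn.continuousOn.mono hsub).div
      (continuousOn_id.rpow_const fun u hu => .inl hu.1.ne')
      fun u hu => (Real.rpow_pos_of_pos hu.1 _).ne')
    (hreg.tendsto_div_rpow.isBigO_one ℝ)
  have hlogDeriv : (fun u => u * logDeriv h u) =O[𝓝[>] 0] fun _ => (1 : ℝ) := by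
    refine (((isBigO_refl (fun u => u / h u) _).mul hreg.deriv_isBigO).congr_left
      fun u => ?_).trans ?_
    · rw [logDeriv_apply]
      ring
    · refine .of_bound 1 (.of_forall fun u => ?_)
      rw [div_mul_div_comm, mul_comm u, norm_div, norm_one, one_mul]
      exact div_self_le_one _
  obtain ⟨C₂, hC₂⟩ := exists_abs_le_of_isBigO_one
    (continuousOn_id.mul (hp.continuousOn_logDeriv.mono hsub)) hlogDeriv
  refine ⟨max C₁ C₂, hp.mono hRL.le, fun u hu => ?_, fun u hu => ?_⟩
  · have hu₁ := (le_abs_self _).trans (hC₁ u (Ioo_subset_Ioc_self hu))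
    rw [← div_le_iff₀ (Real.rpow_pos_of_pos hu.1 _)]
    exact hu₁.trans (le_max_left _ _)
  · have hu₂ := hC₂ u (Ioo_subset_Ioc_self hu)
    rw [Pi.mul_apply, id, abs_mul, abs_of_pos hu.1] at hu₂
    rw [le_div_iff₀' hu.1]
    exact hu₂.trans (le_max_right _ _)

end EdgeProfile

namespace EdgeBound

variable {h : ℝ → ℝ} {κ C R ε u s : ℝ}

lemma const_nonneg (hb : EdgeBound h κ C R) (hR : 0 < R) : 0 ≤ C := by
  have hmid : R / 2 ∈ Ioo 0 R := ⟨half_pos hR, half_lt_self hR⟩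
  simpa [hmid.1.ne'] using mul_nonneg
    ((abs_nonneg _).trans (hb.abs_logDeriv_le _ hmid)) hmid.1.le

lemma abs_log_sub_log_le (hb : EdgeBound h κ C R) (hε : 0 < ε) (hu : 2 * ε ≤ u) (huR : u < R) :
    |Real.log (h (u - ε)) - Real.log (h u)| ≤ 2 * C * (ε / u) := by
  have hu₀ : 0 < u := by linarith
  have hC := hb.const_nonneg (hu₀.trans huR)
  have hmem : ∀ x ∈ Icc (u - ε) u, x ∈ Ioo 0 R := fun x hx =>
    ⟨by linarith [hx.1], hx.2.trans_lt huR⟩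
  have hderiv : ∀ x ∈ Icc (u - ε) u, ‖deriv (fun x => Real.log (h x)) x‖ ≤ 2 * C / u := by
    intro x hx
    rw [hb.deriv_log (hmem x hx), Real.norm_eq_abs]
    refine (hb.abs_logDeriv_le x (hmem x hx)).trans ?_
    rw [div_le_div_iff₀ (hmem x hx).1 hu₀]
    nlinarith [hx.1]
  have hmvt := (convex_Icc (u - ε) u).norm_image_sub_le_of_norm_deriv_le
    (fun x hx => (hb.differentiableAt (hmem x hx)).log (hb.pos x (hmem x hx)).ne') hderiv
    (right_mem_Icc.2 (by linarith)) (left_mem_Icc.2 (by linarith))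
  calc |Real.log (h (u - ε)) - Real.log (h u)| ≤ 2 * C / u * ‖u - ε - u‖ := hmvt
    _ = 2 * C * (ε / u) := by
      rw [sub_sub_cancel_left, norm_neg, Real.norm_of_nonneg hε.le]
      ring

lemma amgmGap_le_of_two_mul_le (hb : EdgeBound h κ C R) (hs : s ∈ Icc (0 : ℝ) 1) (hε : 0 < ε)
    (hu : 2 * ε ≤ u) (huR : u < R) :
    amgmGap s (h u) (h (u - ε)) ≤ 4 * C ^ 2 * Real.exp C * (ε / u) ^ 2 * h u := by
  have hu₀ : 0 < u := by linarith
  have hC := hb.const_nonneg (hu₀.trans huR)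
  have hlog := hb.abs_log_sub_log_le hε hu huR
  have hlogC : |Real.log (h (u - ε)) - Real.log (h u)| ≤ C := by
    refine hlog.trans ?_
    have : ε / u ≤ 1 / 2 := by rw [div_le_div_iff₀ hu₀ two_pos]; linarith
    nlinarith
  have hpos : 0 < h u := hb.pos u ⟨hu₀, huR⟩
  refine (amgmGap_le_mul_sq_log hs hpos (hb.pos _ ⟨by linarith, by linarith⟩)).trans ?_
  calc _ ≤ h u * ((2 * C * (ε / u)) ^ 2 * Real.exp C) := by
        rw [← sq_abs]
        gcongr
    _ = _ := by ring

end EdgeBound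

/-- The contribution to the total defect between `h` and its translate by `ε` of the part of the
line within distance `c` of the edge. -/
noncomputable def edgeInt (h : ℝ → ℝ) (c ε s : ℝ) : ℝ :=
  ∫ u in Ioc 0 c, amgmGap s (h u) (h (u - ε))

/-- The profile `h` seen at the length scale `ε`, normalised so as to fix `u ^ (κ - 1)`. -/
noncomputable def rescale (κ ε : ℝ) (h : ℝ → ℝ) (y : ℝ) : ℝ := ε ^ (1 - κ) * h (ε * y)

/-- An integrable majorant, for `0 < κ < 2`, of the defect between `x ^ (κ - 1)` and its unit
translate. -/
noncomputable def edgeMajorant (κ x : ℝ) : ℝ :=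
  (Ioc 0 2).indicator (fun x => x ^ (κ - 1)) x +
    (Ioc 1 2).indicator (fun x => (x - 1) ^ (κ - 1)) x +
    (Ioi 2).indicator (fun x => x ^ (κ - 3)) x

/-- The defect between `x ^ (κ - 1)` and its unit translate, both vanishing on the negative
half-line. The value on `x ≤ 1` is its limit from within `0 < s < 1`, because `0 ^ 0 = 1` spoils
the defect itself at `s = 1`. -/
noncomputable def edgeKernel (κ s x : ℝ) : ℝ :=
  if x ≤ 1 then s * x ^ (κ - 1) else amgmGap s (x ^ (κ - 1)) ((x - 1) ^ (κ - 1))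

/-- The total defect between `x ^ (κ - 1)` on the half-line and its unit translate. -/
noncomputable def edgeConst (κ s : ℝ) : ℝ := ∫ x in Ioi 0, edgeKernel κ s x

lemma integrable_edgeMajorant {κ : ℝ} (h₀ : 0 < κ) (h₂ : κ < 2) : Integrable (edgeMajorant κ) := by
  have hpow (a b : ℝ) : IntervalIntegrable (fun x : ℝ => x ^ (κ - 1)) volume a b :=
    intervalIntegral.intervalIntegrable_rpow' (by linarith)
  have hshift : IntervalIntegrable (fun x : ℝ => (x - 1) ^ (κ - 1)) volume 1 2 := by
    convert (hpow 0 1).comp_sub_right 1 using 1 <;> norm_num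
  have htail : IntegrableOn (fun x : ℝ => x ^ (κ - 3)) (Ioi 2) :=
    integrableOn_Ioi_rpow_of_lt (by linarith) two_pos
  exact (((hpow 0 2).1.integrable_indicator measurableSet_Ioc).add
    (hshift.1.integrable_indicator measurableSet_Ioc)).add
    (htail.integrable_indicator measurableSet_Ioi)

lemma edgeMajorant_nonneg (κ x : ℝ) : 0 ≤ edgeMajorant κ x := by
  refine add_nonneg (add_nonneg ?_ ?_) ?_ <;> refine indicator_nonneg (fun y hy => ?_) _
  · exact Real.rpow_nonneg hy.1.le _
  · exact Real.rpow_nonneg (sub_nonneg.2 hy.1.le) _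
  · exact Real.rpow_nonneg (two_pos.trans hy).le _

lemma edgeKernel_nonneg {κ s x : ℝ} (hs : s ∈ Icc (0 : ℝ) 1) (hx : 0 < x) :
    0 ≤ edgeKernel κ s x := by
  unfold edgeKernel
  split_ifs with hx₁
  · exact mul_nonneg hs.1 (Real.rpow_nonneg hx.le _)
  · exact amgmGap_nonneg hs (Real.rpow_nonneg hx.le _) (Real.rpow_nonneg (by linarith) _)

lemma measurable_edgeKernel (κ s : ℝ) : Measurable (edgeKernel κ s) :=
  Measurable.ite measurableSet_Iic (by fun_prop) (measurable_amgmGap s (by fun_prop) (by fun_prop))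

namespace EdgeBound

variable {h : ℝ → ℝ} {κ C R ε s x : ℝ}

protected lemma rescale (hb : EdgeBound h κ C R) (hε : 0 < ε) :
    EdgeBound (rescale κ ε h) κ C (R / ε) := by
  have hmem : ∀ {y : ℝ}, y ∈ Ioo 0 (R / ε) → ε * y ∈ Ioo 0 R := fun hy =>
    ⟨mul_pos hε hy.1, (lt_div_iff₀' hε).1 hy.2⟩
  have hpos : 0 < ε ^ (1 - κ) := Real.rpow_pos_of_pos hε _
  refine ⟨⟨?_, fun y => mul_nonneg hpos.le (hb.nonneg _), fun y hy => ?_,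
    fun y hy => mul_pos hpos (hb.pos _ (hmem hy)), ?_⟩, fun y hy => ?_, fun y hy => ?_⟩
  · exact (hb.measurable.comp (measurable_const_mul ε)).const_mul _
  · rw [rescale, hb.eq_zero _ (mul_nonpos_of_nonneg_of_nonpos hε.le hy), mul_zero]
  · exact contDiffOn_const.mul
      (hb.contDiffOn.comp (contDiffOn_const.mul contDiffOn_id) fun y hy => hmem hy)
  · calc ε ^ (1 - κ) * h (ε * y) ≤ ε ^ (1 - κ) * (C * (ε * y) ^ (κ - 1)) := by
          gcongr
          exact hb.le_rpow _ (hmem hy)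
      _ = C * y ^ (κ - 1) * (ε ^ (1 - κ) * ε ^ (κ - 1)) := by
          rw [Real.mul_rpow hε.le hy.1.le]
          ring
      _ = C * y ^ (κ - 1) := by
          rw [← Real.rpow_add hε, sub_add_sub_cancel, sub_self, Real.rpow_zero, mul_one]
  · have hlog : logDeriv (rescale κ ε h) y = logDeriv h (ε * y) * ε := by
      unfold rescale
      rw [logDeriv_const_mul _ _ hpos.ne', ← Function.comp_def h, logDeriv_comp
        (hb.differentiableAt (hmem hy)) (by fun_prop), deriv_const_mul_id]
    calc |logDeriv (rescale κ ε h) y| = |logDeriv h (ε * y)| * ε := by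
          rw [hlog, abs_mul, abs_of_pos hε]
      _ ≤ C / (ε * y) * ε := by
          gcongr
          exact hb.abs_logDeriv_le _ (hmem hy)
      _ = C / y := by
          field_simp

lemma add_apply_sub_one_le (hb : EdgeBound h κ C R) (hx : x ∈ Ioc 0 2) (hxR : x < R) :
    h x + h (x - 1) ≤ C * edgeMajorant κ x := by
  have hcut : x ∉ Ioi (2 : ℝ) := notMem_Ioi.2 hx.2
  rw [edgeMajorant, indicator_of_mem hx,
    indicator_of_notMem hcut, add_zero, mul_add]
  refine add_le_add (hb.le_rpow x ⟨hx.1, hxR⟩) ?_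
  rcases le_or_gt x 1 with hx₁ | hx₁
  · rw [hb.eq_zero _ (by linarith), indicator_of_notMem (fun hmem => hx₁.not_gt hmem.1),
      mul_zero]
  · rw [indicator_of_mem (show x ∈ Ioc 1 2 from ⟨hx₁, hx.2⟩)]
    exact hb.le_rpow _ ⟨by linarith, by linarith⟩

lemma amgmGap_sub_one_le (hb : EdgeBound h κ C R) (hs : s ∈ Icc (0 : ℝ) 1) (hx : x ∈ Ioo 0 R) :
    amgmGap s (h x) (h (x - 1)) ≤ (C + 4 * C ^ 3 * Real.exp C) * edgeMajorant κ x := by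
  have hC := hb.const_nonneg (hx.1.trans hx.2)
  rcases le_or_gt x 2 with hx₂ | hx₂
  · have hnear := hb.add_apply_sub_one_le ⟨hx.1, hx₂⟩ hx.2
    refine (amgmGap_le_add hs (hb.nonneg _) (hb.nonneg _)).trans (hnear.trans ?_)
    exact mul_le_mul_of_nonneg_right (le_add_of_nonneg_right (by positivity))
      (edgeMajorant_nonneg κ x)
  · have hmaj : edgeMajorant κ x = x ^ (κ - 3) := by
      rw [edgeMajorant, indicator_of_notMem (fun hmem => hx₂.not_ge hmem.2),
        indicator_of_notMem (fun hmem => hx₂.not_ge hmem.2), indicator_of_mem (mem_Ioi.2 hx₂),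
        zero_add, zero_add]
    have hpow : (1 / x) ^ 2 * x ^ (κ - 1) = x ^ (κ - 3) := by
      rw [one_div, inv_pow, ← Real.rpow_natCast, ← Real.rpow_neg hx.1.le, ← Real.rpow_add hx.1]
      norm_num
      ring_nf
    calc amgmGap s (h x) (h (x - 1))
        ≤ 4 * C ^ 2 * Real.exp C * (1 / x) ^ 2 * h x :=
          hb.amgmGap_le_of_two_mul_le hs one_pos (by linarith) hx.2
      _ ≤ 4 * C ^ 2 * Real.exp C * (1 / x) ^ 2 * (C * x ^ (κ - 1)) := by
          gcongr
          exact hb.le_rpow x hx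
      _ = 4 * C ^ 3 * Real.exp C * edgeMajorant κ x := by
          rw [hmaj, ← hpow]
          ring
      _ ≤ (C + 4 * C ^ 3 * Real.exp C) * edgeMajorant κ x :=
          mul_le_mul_of_nonneg_right (le_add_of_nonneg_left hC) (edgeMajorant_nonneg κ x)

end EdgeBound

lemma edgeInt_div_rpow {h : ℝ → ℝ} {ε : ℝ} (hh : ∀ u, 0 ≤ h u) (hε : 0 < ε) (κ c s : ℝ) :
    edgeInt h c ε s / ε ^ κ = edgeInt (rescale κ ε h) (c / ε) 1 s := by
  have hfactor (y : ℝ) : amgmGap s (rescale κ ε h y) (rescale κ ε h (y - 1)) =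
      ε ^ (1 - κ) * amgmGap s (h (ε • y)) (h (ε • y - ε)) := by
    rw [rescale, rescale, amgmGap_mul_left (Real.rpow_pos_of_pos hε _) (hh _) (hh _), smul_eq_mul,
      mul_sub_one]
  unfold edgeInt
  simp_rw [hfactor]
  rw [integral_const_mul, Measure.setIntegral_comp_smul_of_pos volume
    (fun u => amgmGap s (h u) (h (u - ε))) _ hε, LinearOrderedField.smul_Ioc hε, mul_zero,
    mul_div_cancel₀ _ hε.ne', Module.finrank_self, pow_one, smul_eq_mul, Real.rpow_sub hε,
    Real.rpow_one]
  field_simp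

lemma edgeInt_eq_integral_Ioi (h : ℝ → ℝ) (c ε s : ℝ) :
    edgeInt h c ε s =
      ∫ u in Ioi 0, (Iic c).indicator (fun u => amgmGap s (h u) (h (u - ε))) u := by
  rw [setIntegral_indicator measurableSet_Iic, Ioi_inter_Iic, edgeInt]

lemma tendsto_rescale {ι : Type*} {l : Filter ι} {ε : ι → ℝ} {h : ℝ → ℝ} {κ A x : ℝ}
    (hlim : Tendsto (fun u => h u / u ^ (κ - 1)) (𝓝[>] 0) (𝓝 A)) (hε : Tendsto ε l (𝓝[>] 0))
    (hx : 0 < x) : Tendsto (fun i => rescale κ (ε i) h x) l (𝓝 (A * x ^ (κ - 1))) := by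
  have hεx : Tendsto (fun i => ε i * x) l (𝓝[>] 0) :=
    zero_mul x ▸ TendstoNhdsWithinIoi.mul_const hx hε
  refine ((hlim.comp hεx).mul_const (x ^ (κ - 1))).congr' ?_
  filter_upwards [hε.eventually self_mem_nhdsWithin] with i (hi : 0 < ε i)
  have hpow : (ε i) ^ (1 - κ) * (ε i) ^ (κ - 1) = 1 := by
    rw [← Real.rpow_add hi, sub_add_sub_cancel, sub_self, Real.rpow_zero]
  rw [Function.comp_apply, rescale, Real.mul_rpow hi.le hx.le, div_mul_eq_mul_div,
    mul_div_mul_right _ _ (Real.rpow_pos_of_pos hx _).ne', ← inv_mul_eq_div,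
    eq_inv_of_mul_eq_one_left hpow]

section SubcriticalEdge

variable {ι : Type*} {l : Filter ι} {ε s c : ι → ℝ} {h : ℝ → ℝ} {κ C A R s₀ c₀ x : ℝ}

lemma nonneg_of_tendsto_div_rpow (hh : ∀ u, 0 ≤ h u)
    (hlim : Tendsto (fun u => h u / u ^ (κ - 1)) (𝓝[>] 0) (𝓝 A)) : 0 ≤ A := by
  refine ge_of_tendsto hlim ?_
  filter_upwards [self_mem_nhdsWithin] with u (hu : 0 < u)
  exact div_nonneg (hh u) (Real.rpow_nonneg hu.le _)

lemma tendsto_amgmGap_rescale (hh : ∀ u, 0 ≤ h u) (hh₀ : ∀ u ≤ 0, h u = 0)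
    (hlim : Tendsto (fun u => h u / u ^ (κ - 1)) (𝓝[>] 0) (𝓝 A)) (hε : Tendsto ε l (𝓝[>] 0))
    (hs : Tendsto s l (𝓝[Ioo 0 1] s₀)) (hx : 0 < x) (hx₁ : x ≠ 1) :
    Tendsto (fun i => amgmGap (s i) (rescale κ (ε i) h x) (rescale κ (ε i) h (x - 1))) l
      (𝓝 (A * edgeKernel κ s₀ x)) := by
  have hs' := tendsto_nhds_of_tendsto_nhdsWithin hs
  have hεpos : ∀ᶠ i in l, 0 < ε i := hε.eventually self_mem_nhdsWithin
  have hs01 : ∀ᶠ i in l, s i ∈ Ioo 0 1 := hs.eventually self_mem_nhdsWithin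
  have hlim₀ := tendsto_rescale hlim hε hx
  rcases hx₁.lt_or_gt with hx₁ | hx₁
  · have hkernel : A * edgeKernel κ s₀ x = s₀ * (A * x ^ (κ - 1)) := by
      rw [edgeKernel, if_pos hx₁.le]
      ring
    rw [hkernel]
    refine (hs'.mul hlim₀).congr' ?_
    filter_upwards [hεpos, hs01] with i hεi hsi
    have hzero : h (ε i * (x - 1)) = 0 :=
      hh₀ _ (mul_nonpos_of_nonneg_of_nonpos hεi.le (by linarith))
    rw [rescale, rescale, hzero, mul_zero, amgmGap_zero_right hsi.2.ne]
  have hlim₁ := tendsto_rescale hlim hε (sub_pos.2 hx₁)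
  rw [edgeKernel, if_neg hx₁.not_ge]
  rcases (nonneg_of_tendsto_div_rpow hh hlim).eq_or_lt with rfl | hA
  · rw [zero_mul] at hlim₀ hlim₁ ⊢
    have hnonneg : ∀ y, ∀ᶠ i in l, 0 ≤ rescale κ (ε i) h y := fun y =>
      hεpos.mono fun i hεi => mul_nonneg (Real.rpow_nonneg hεi.le _) (hh _)
    exact tendsto_amgmGap_zero (hs01.mono fun i hsi => Ioo_subset_Icc_self hsi) hlim₀ hlim₁
      (hnonneg _) (hnonneg _)
  · have : 0 < x - 1 := sub_pos.2 hx₁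
    rw [← amgmGap_mul_left hA (by positivity) (by positivity)]
    exact tendsto_amgmGap hs' hlim₀ hlim₁ (by positivity) (by positivity)

lemma EdgeBound.tendsto_edgeInt_div_rpow [l.IsCountablyGenerated] (hb : EdgeBound h κ C R)
    (hlim : Tendsto (fun u => h u / u ^ (κ - 1)) (𝓝[>] 0) (𝓝 A)) (hκ₀ : 0 < κ) (hκ₂ : κ < 2)
    (hε : Tendsto ε l (𝓝[>] 0)) (hs : Tendsto s l (𝓝[Ioo 0 1] s₀)) (hc : Tendsto c l (𝓝 c₀))
    (hc₀ : 0 < c₀) (hc₀R : c₀ < R) :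
    Tendsto (fun i => edgeInt h (c i) (ε i) (s i) / ε i ^ κ) l (𝓝 (A * edgeConst κ s₀)) := by
  have hεpos : ∀ᶠ i in l, 0 < ε i := hε.eventually self_mem_nhdsWithin
  have hs01 : ∀ᶠ i in l, s i ∈ Ioo 0 1 := hs.eventually self_mem_nhdsWithin
  have hcε : Tendsto (fun i => c i / ε i) l atTop :=
    hc.pos_mul_atTop hc₀ (tendsto_inv_nhdsGT_zero.comp hε)
  rw [edgeConst, ← integral_const_mul]
  suffices hdom : Tendsto (fun i => ∫ y in Ioi 0, (Iic (c i / ε i)).indicator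
      (fun y => amgmGap (s i) (rescale κ (ε i) h y) (rescale κ (ε i) h (y - 1))) y) l
      (𝓝 (∫ y in Ioi 0, A * edgeKernel κ s₀ y)) by
    refine hdom.congr' ?_
    filter_upwards [hεpos] with i hεi
    rw [edgeInt_div_rpow hb.nonneg hεi, edgeInt_eq_integral_Ioi]
  refine tendsto_integral_filter_of_dominated_convergence
    (fun y => (C + 4 * C ^ 3 * Real.exp C) * edgeMajorant κ y) ?_ ?_
    ((integrable_edgeMajorant hκ₀ hκ₂).integrableOn.const_mul _) ?_
  · filter_upwards [hεpos] with i hεi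
    have hmeas := (hb.rescale hεi).measurable
    exact ((measurable_amgmGap _ hmeas (hmeas.comp (measurable_sub_const 1))).indicator
      measurableSet_Iic).aestronglyMeasurable
  · filter_upwards [hεpos, hs01, hc.eventually_lt_const hc₀R] with i hεi hsi hcR
    have hC := hb.const_nonneg (hc₀.trans hc₀R)
    filter_upwards [ae_restrict_mem measurableSet_Ioi] with y hy
    have hnonneg : 0 ≤ (C + 4 * C ^ 3 * Real.exp C) * edgeMajorant κ y :=
      mul_nonneg (by positivity) (edgeMajorant_nonneg κ y)
    by_cases hcut : y ∈ Iic (c i / ε i)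
    · have hres := hb.rescale hεi
      have hs' := Ioo_subset_Icc_self hsi
      rw [indicator_of_mem hcut,
        Real.norm_of_nonneg (amgmGap_nonneg hs' (hres.nonneg _) (hres.nonneg _))]
      exact hres.amgmGap_sub_one_le hs' ⟨hy, hcut.trans_lt (by gcongr)⟩
    · rwa [indicator_of_notMem hcut, norm_zero]
  · filter_upwards [ae_restrict_mem measurableSet_Ioi,
      ae_restrict_of_ae (Measure.ae_ne volume 1)] with y hy hy₁
    refine (tendsto_amgmGap_rescale hb.nonneg hb.eq_zero hlim hε hs hy hy₁).congr' ?_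
    filter_upwards [hcε.eventually_ge_atTop y] with i hi
    rw [indicator_of_mem (mem_Iic.2 hi)]

end SubcriticalEdge

section PowerProfile

variable {κ s : ℝ}

lemma edgeBound_rpow (κ R : ℝ) :
    EdgeBound ((Ioi 0).indicator fun u => u ^ (κ - 1)) κ (max 1 |κ - 1|) R := by
  set P : ℝ → ℝ := (Ioi 0).indicator fun u => u ^ (κ - 1)
  have hP : EqOn P (fun u => u ^ (κ - 1)) (Ioi 0) := eqOn_indicator
  refine ⟨⟨(measurable_id.pow_const _).indicator measurableSet_Ioi, fun u =>
    indicator_nonneg (fun v hv => Real.rpow_nonneg (le_of_lt hv) _) u,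
    fun u hu => indicator_of_notMem (notMem_Ioi.2 hu) _, fun u hu => ?_, ?_⟩,
    fun u hu => ?_, fun u hu => ?_⟩
  · exact (Real.rpow_pos_of_pos hu.1 _).trans_eq (hP hu.1).symm
  · exact ContDiffOn.congr
      (fun u hu => (Real.contDiffAt_rpow_const_of_ne hu.1.ne').contDiffWithinAt)
      fun u hu => hP hu.1
  · exact (hP hu.1).trans_le
      (le_mul_of_one_le_left (Real.rpow_nonneg hu.1.le _) (le_max_left _ _))
  · have hlog : logDeriv P u = (κ - 1) / u := by
      have hderiv := (hP.eventuallyEq_of_mem (Ioi_mem_nhds hu.1)).deriv_eq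
      rw [logDeriv_apply, hderiv, hP hu.1, (Real.hasDerivAt_rpow_const (.inl hu.1.ne')).deriv,
        Real.rpow_sub_one hu.1.ne']
      field_simp [(Real.rpow_pos_of_pos hu.1 (κ - 1)).ne']
    rw [hlog, abs_div, abs_of_pos hu.1]
    exact div_le_div_of_nonneg_right (le_max_right _ _) hu.1.le

lemma edgeKernel_eq_amgmGap (hs : s ≠ 1) {x : ℝ} (hx : 0 < x) :
    edgeKernel κ s x = amgmGap s ((Ioi 0).indicator (fun u => u ^ (κ - 1)) x)
      ((Ioi 0).indicator (fun u => u ^ (κ - 1)) (x - 1)) := by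
  rw [indicator_of_mem (mem_Ioi.2 hx), edgeKernel]
  split_ifs with hx₁
  · rw [indicator_of_notMem (notMem_Ioi.2 (sub_nonpos.2 hx₁)), amgmGap_zero_right hs]
  · rw [indicator_of_mem (mem_Ioi.2 (sub_pos.2 (not_le.1 hx₁)))]

lemma integrableOn_edgeKernel (hκ₀ : 0 < κ) (hκ₂ : κ < 2) (hs : s ∈ Ioo (0 : ℝ) 1) :
    IntegrableOn (edgeKernel κ s) (Ioi 0) := by
  set C := max 1 |κ - 1|
  refine ((integrable_edgeMajorant hκ₀ hκ₂).integrableOn.const_mul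
    (C + 4 * C ^ 3 * Real.exp C)).mono' (measurable_edgeKernel κ s).aestronglyMeasurable ?_
  filter_upwards [ae_restrict_mem measurableSet_Ioi] with x (hx : 0 < x)
  have hs' := Ioo_subset_Icc_self hs
  rw [Real.norm_of_nonneg (edgeKernel_nonneg hs' hx), edgeKernel_eq_amgmGap hs.2.ne hx]
  exact (edgeBound_rpow κ (x + 1)).amgmGap_sub_one_le hs' ⟨hx, lt_add_one x⟩

end PowerProfile

section Beta

open ProbabilityTheory

variable {a b : ℝ}

lemma betaPDFReal_nonneg (ha : 0 < a) (hb : 0 < b) (x : ℝ) : 0 ≤ betaPDFReal a b x := by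
  by_cases hx : 0 < x ∧ x < 1
  · exact (betaPDFReal_pos hx.1 hx.2 ha hb).le
  · exact (if_neg hx).ge

lemma integrable_betaPDFReal (ha : 0 < a) (hb : 0 < b) : Integrable (betaPDFReal a b) :=
  (lintegral_ofReal_ne_top_iff_integrable (by fun_prop)
    (ae_of_all _ (betaPDFReal_nonneg ha hb))).1
    ((lintegral_betaPDF_eq_one ha hb).trans_ne (by simp))

lemma setIntegral_Ioi_betaPDFReal (ha : 0 < a) (hb : 0 < b) :
    ∫ x in Ioi 0, betaPDFReal a b x = 1 := by
  have hsupp : ∀ x ∉ Ioi 0, betaPDFReal a b x = 0 := fun x hx => if_neg fun h => hx h.1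
  rw [setIntegral_eq_integral_of_forall_compl_eq_zero hsupp,
    integral_eq_lintegral_of_nonneg_ae (ae_of_all _ (betaPDFReal_nonneg ha hb)) (by fun_prop)]
  exact congrArg ENNReal.toReal (lintegral_betaPDF_eq_one ha hb)

lemma rpow_mul_betaPDFReal_inv {x : ℝ} (hx : 0 < x) :
    (|(-1 : ℝ)| * x ^ ((-1 : ℝ) - 1)) • betaPDFReal a b (x ^ (-1 : ℝ)) =
      (Ioi 1).indicator (fun x => (beta a b)⁻¹ * (x ^ (-(a + b)) * (x - 1) ^ (b - 1))) x := by
  rw [Real.rpow_neg_one]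
  by_cases hx₁ : 1 < x
  · have hsub : 1 - x⁻¹ = (x - 1) * x⁻¹ := by field_simp
    have hpow : x ^ (-(a + b)) = x ^ ((-1 : ℝ) - 1) * x⁻¹ ^ (a - 1) * x⁻¹ ^ (b - 1) := by
      rw [← Real.rpow_neg_eq_inv_rpow, ← Real.rpow_neg_eq_inv_rpow, ← Real.rpow_add hx,
        ← Real.rpow_add hx]
      ring_nf
    rw [indicator_of_mem (mem_Ioi.2 hx₁), betaPDFReal,
      if_pos ⟨inv_pos.2 hx, inv_lt_one_of_one_lt₀ hx₁⟩, hsub,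
      Real.mul_rpow (sub_pos.2 hx₁).le (inv_pos.2 hx).le, hpow, abs_neg, abs_one, smul_eq_mul,
      one_div]
    ring
  · rw [indicator_of_notMem (notMem_Ioi.2 (not_lt.1 hx₁)), betaPDFReal,
      if_neg fun h => hx₁ ((inv_lt_one₀ hx).1 h.2), smul_zero]

lemma integrableOn_Ioi_rpow_mul_sub_one_rpow (ha : 0 < a) (hb : 0 < b) :
    IntegrableOn (fun x : ℝ => x ^ (-(a + b)) * (x - 1) ^ (b - 1)) (Ioi 1) := by
  have hsubst := (integrableOn_Ioi_comp_rpow_iff _ (neg_ne_zero.2 one_ne_zero)).2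
    (integrable_betaPDFReal ha hb).integrableOn
  have hInt := hsubst.congr_fun (fun x hx => rpow_mul_betaPDFReal_inv hx) measurableSet_Ioi
  rw [IntegrableOn, integrable_indicator_iff measurableSet_Ioi, IntegrableOn,
    Measure.restrict_restrict measurableSet_Ioi, Ioi_inter_Ioi, max_eq_left zero_le_one] at hInt
  exact (hInt.const_mul (beta a b)).congr (ae_of_all _ fun x =>
    mul_inv_cancel_left₀ (beta_pos ha hb).ne' _)

lemma integral_Ioi_rpow_mul_sub_one_rpow (ha : 0 < a) (hb : 0 < b) :
    ∫ x in Ioi 1, x ^ (-(a + b)) * (x - 1) ^ (b - 1) = beta a b := by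
  have hsubst := integral_comp_rpow_Ioi (betaPDFReal a b) (neg_ne_zero.2 one_ne_zero)
  rw [setIntegral_Ioi_betaPDFReal ha hb, setIntegral_congr_fun measurableSet_Ioi
    fun x hx => rpow_mul_betaPDFReal_inv hx, setIntegral_indicator measurableSet_Ioi,
    Ioi_inter_Ioi, max_eq_right zero_le_one, integral_const_mul] at hsubst
  exact (inv_mul_eq_one₀ (beta_pos ha hb).ne').1 hsubst |>.symm

end Beta

section ClosedForm

variable {κ s : ℝ}

/-- Up to a multiple of a beta integrand, a primitive of `edgeKernel κ s` on `1 < x`. It comes from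
integrating by parts in the mixed term `x ^ (s (κ - 1)) (x - 1) ^ ((1 - s) (κ - 1))`. -/
noncomputable def edgePrimitive (κ s x : ℝ) : ℝ :=
  (s * x ^ κ + (1 - s) * (x - 1) ^ κ - x ^ (s * (κ - 1)) * (x - 1) ^ (s + κ * (1 - s)) -
    s * (x ^ (s * (κ - 1) - 1) * (x - 1) ^ (s + κ * (1 - s)))) / κ

lemma hasDerivAt_edgePrimitive {x : ℝ} (hκ₀ : κ ≠ 0) (hx : 1 < x) :
    HasDerivAt (edgePrimitive κ s) (edgeKernel κ s x - s * (1 - s * (κ - 1)) / κ *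
      (x ^ (s * (κ - 1) - 2) * (x - 1) ^ (s + κ * (1 - s) - 1))) x := by
  have hx₀ : 0 < x := one_pos.trans hx
  have hx₁ : 0 < x - 1 := sub_pos.2 hx
  have hpow (p : ℝ) : HasDerivAt (fun x : ℝ => x ^ p) (p * x ^ (p - 1)) x :=
    Real.hasDerivAt_rpow_const (Or.inl hx₀.ne')
  have hpow₁ (p : ℝ) : HasDerivAt (fun x : ℝ => (x - 1) ^ p) (p * (x - 1) ^ (p - 1)) x := by
    simpa using ((hasDerivAt_id x).sub_const 1).rpow_const (p := p) (Or.inl hx₁.ne')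
  refine HasDerivAt.congr_deriv (f := edgePrimitive κ s)
    ((((((hpow κ).const_mul s).add ((hpow₁ κ).const_mul (1 - s))).sub
      ((hpow (s * (κ - 1))).mul (hpow₁ (s + κ * (1 - s))))).sub
      (((hpow (s * (κ - 1) - 1)).mul (hpow₁ (s + κ * (1 - s)))).const_mul s)).div_const κ) ?_
  have hone : x ^ (s * (κ - 1) - 1) = x ^ (s * (κ - 1) - 2) * x := by
    rw [← Real.rpow_add_one hx₀.ne']
    ring_nf
  have hzero : x ^ (s * (κ - 1)) = x ^ (s * (κ - 1) - 2) * x * x := by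
    rw [← hone, ← Real.rpow_add_one hx₀.ne', sub_add_cancel]
  have htop : (x - 1) ^ (s + κ * (1 - s)) = (x - 1) ^ (s + κ * (1 - s) - 1) * (x - 1) := by
    rw [← Real.rpow_add_one hx₁.ne', sub_add_cancel]
  rw [edgeKernel, if_neg hx.not_ge, amgmGap, ← Real.rpow_mul hx₀.le, ← Real.rpow_mul hx₁.le,
    show (κ - 1) * s = s * (κ - 1) by ring,
    show (κ - 1) * (1 - s) = s + κ * (1 - s) - 1 by ring,
    show s * (κ - 1) - 1 - 1 = s * (κ - 1) - 2 by ring, hzero, hone, htop]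
  field_simp
  ring

lemma one_sub_rpow_sub_linear_isBigO (p : ℝ) :
    (fun y : ℝ => (1 - y) ^ p - (1 - p * y)) =O[𝓝 0] fun y => y ^ 2 := by
  have htaylor := (Real.one_add_rpow_hasFPowerSeriesAt_zero (a := p)).isBigO_sub_partialSum_pow 2
  have hneg : Tendsto (fun y : ℝ => -y) (𝓝 0) (𝓝 0) := by
    simpa using (continuous_neg (G := ℝ)).tendsto 0
  have hpartial (y : ℝ) : (binomialSeries ℝ p).partialSum 2 y = 1 + p * y := by
    simp [FormalMultilinearSeries.partialSum, binomialSeries, Finset.sum_range_succ, mul_comm]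
  refine (htaylor.comp_tendsto hneg).congr (fun y => ?_) fun y => by simp
  rw [Function.comp_apply, hpartial]
  ring_nf

lemma tendsto_edgePrimitive (hκ₂ : κ < 2) : Tendsto (edgePrimitive κ s) atTop (𝓝 0) := by
  set β := s + κ * (1 - s) with hβ
  set Φ : ℝ → ℝ := fun y => s + (1 - s) * (1 - y) ^ κ - (1 + s * y) * (1 - y) ^ β with hΦ
  have hsquare : Φ =O[𝓝 0] fun y => y ^ 2 := by
    have hfactor : (fun y : ℝ => 1 + s * y) =O[𝓝 0] fun _ => (1 : ℝ) :=
      (show Continuous fun y : ℝ => 1 + s * y by fun_prop).continuousAt.tendsto.isBigO_one ℝ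
    have hβ' := hfactor.mul (one_sub_rpow_sub_linear_isBigO β)
    simp only [one_mul] at hβ'
    refine ((((one_sub_rpow_sub_linear_isBigO κ).const_mul_left (1 - s)).add
      ((isBigO_refl (fun y : ℝ => y ^ 2) _).const_mul_left (s * β))).sub hβ').congr_left fun y => ?_
    simp only [Φ, hβ]
    ring
  have hlim : Tendsto (fun y => Φ y / y ^ κ) (𝓝[>] 0) (𝓝 0) := by
    refine ((hsquare.mono nhdsWithin_le_nhds).mul (isBigO_refl (fun y : ℝ => (y ^ κ)⁻¹) _)
      ).trans_tendsto ?_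
    refine (tendsto_nhds_of_tendsto_nhdsWithin
      (tendsto_rpow_nhdsGT_zero (sub_pos.2 hκ₂))).congr' ?_
    filter_upwards [self_mem_nhdsWithin] with y (hy : 0 < y)
    rw [Real.rpow_sub hy, Real.rpow_two, div_eq_mul_inv]
  refine (zero_div κ ▸ (hlim.comp tendsto_inv_atTop_nhdsGT_zero).div_const κ).congr' ?_
  filter_upwards [eventually_gt_atTop 1] with x hx
  have hx₀ : 0 < x := one_pos.trans hx
  have hx₁ : 0 < x - 1 := sub_pos.2 hx
  have hsub : 1 - x⁻¹ = (x - 1) / x := by field_simp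
  have hpow : x ^ (s * (κ - 1)) = x ^ κ / x ^ β := by
    rw [← Real.rpow_sub hx₀, hβ]
    ring_nf
  rw [Function.comp_apply, edgePrimitive, Real.rpow_sub_one hx₀.ne', hpow, ← hβ, hΦ]
  simp only [hsub, Real.div_rpow hx₁.le hx₀.le, Real.inv_rpow hx₀.le]
  have : 0 < x ^ κ := Real.rpow_pos_of_pos hx₀ κ
  field_simp
  ring

lemma integral_Ioc_edgeKernel (hκ₀ : 0 < κ) : ∫ x in Ioc 0 1, edgeKernel κ s x = s / κ := by
  have hkernel : EqOn (edgeKernel κ s) (fun x => s * x ^ (κ - 1)) (Ioc 0 1) := fun x hx =>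
    if_pos hx.2
  rw [setIntegral_congr_fun measurableSet_Ioc hkernel, integral_const_mul,
    ← intervalIntegral.integral_of_le zero_le_one, integral_rpow (Or.inl (by linarith)),
    sub_add_cancel, Real.one_rpow, Real.zero_rpow hκ₀.ne', sub_zero, mul_one_div]

lemma continuousAt_edgePrimitive_one (hκ₀ : 0 ≤ κ) (hβ : 0 ≤ s + κ * (1 - s)) :
    ContinuousAt (edgePrimitive κ s) 1 := by
  have hpow (p : ℝ) : ContinuousAt (fun x : ℝ => x ^ p) 1 :=
    Real.continuousAt_rpow_const 1 p (Or.inl one_ne_zero)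
  have hpow₁ {p : ℝ} (hp : 0 ≤ p) : ContinuousAt (fun x : ℝ => (x - 1) ^ p) 1 :=
    (continuousAt_id.sub continuousAt_const).rpow_const (Or.inr hp)
  exact ((((continuousAt_const.mul (hpow κ)).add (continuousAt_const.mul (hpow₁ hκ₀))).sub
    ((hpow _).mul (hpow₁ hβ))).sub (continuousAt_const.mul ((hpow _).mul (hpow₁ hβ)))).div_const κ

lemma edgePrimitive_one (hκ₀ : κ ≠ 0) (hβ : s + κ * (1 - s) ≠ 0) :
    edgePrimitive κ s 1 = s / κ := by
  simp [edgePrimitive, Real.zero_rpow hκ₀, Real.zero_rpow hβ]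

lemma edgeConst_eq (hκ₀ : 0 < κ) (hκ₂ : κ < 2) (hs : s ∈ Ioo (0 : ℝ) 1) :
    edgeConst κ s =
      s * (1 - s * (κ - 1)) * ProbabilityTheory.beta (s + κ * (1 - s)) (2 - κ) / κ := by
  have hβ : 0 < s + κ * (1 - s) := add_pos hs.1 (mul_pos hκ₀ (sub_pos.2 hs.2))
  have hexp : -(2 - κ + (s + κ * (1 - s))) = s * (κ - 1) - 2 := by ring
  have hint := integrableOn_edgeKernel hκ₀ hκ₂ hs
  have hint₀ := hint.mono_set (Ioc_subset_Ioi_self : Ioc (0 : ℝ) 1 ⊆ Ioi 0)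
  have hint₁ := hint.mono_set (Ioi_subset_Ioi (zero_le_one' ℝ))
  have hbeta := (integrableOn_Ioi_rpow_mul_sub_one_rpow (sub_pos.2 hκ₂) hβ).const_mul
    (s * (1 - s * (κ - 1)) / κ)
  rw [hexp] at hbeta
  have hftc := integral_Ioi_of_hasDerivAt_of_tendsto
    (continuousAt_edgePrimitive_one hκ₀.le hβ.le).continuousWithinAt
    (fun x hx => hasDerivAt_edgePrimitive hκ₀.ne' hx) (hint₁.sub hbeta) (tendsto_edgePrimitive hκ₂)
  rw [integral_sub hint₁ hbeta, integral_const_mul, ← hexp,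
    integral_Ioi_rpow_mul_sub_one_rpow (sub_pos.2 hκ₂) hβ, edgePrimitive_one hκ₀.ne' hβ.ne'] at hftc
  have hsymm : ProbabilityTheory.beta (2 - κ) (s + κ * (1 - s)) =
      ProbabilityTheory.beta (s + κ * (1 - s)) (2 - κ) := by
    rw [ProbabilityTheory.beta, ProbabilityTheory.beta, mul_comm, add_comm (2 - κ)]
  rw [edgeConst, ← Ioc_union_Ioi_eq_Ioi (zero_le_one' ℝ),
    setIntegral_union Ioc_disjoint_Ioi_same measurableSet_Ioi hint₀ hint₁,
    integral_Ioc_edgeKernel hκ₀, ← hsymm]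
  linear_combination hftc

lemma edgeConst_one (hs : s ∈ Ioo (0 : ℝ) 1) : edgeConst 1 s = s := by
  rw [edgeConst_eq one_pos one_lt_two hs]
  norm_num [ProbabilityTheory.beta]

lemma edgeConst_eq_of_lt_one (hκ₀ : 0 < κ) (hκ₁ : κ < 1) (hs : s ∈ Ioo (0 : ℝ) 1) :
    edgeConst κ s =
      (1 - κ) / κ * (s * ProbabilityTheory.beta (s + κ * (1 - s)) (1 - κ)) := by
  have hp : 0 < 1 - s * (κ - 1) := by nlinarith [hs.1]
  have hsum : s + κ * (1 - s) + (1 - κ) = 1 - s * (κ - 1) := by ring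
  have hsum' : s + κ * (1 - s) + (1 - κ + 1) = 1 - s * (κ - 1) + 1 := by ring
  rw [edgeConst_eq hκ₀ (by linarith) hs, ProbabilityTheory.beta, ProbabilityTheory.beta,
    show 2 - κ = 1 - κ + 1 by ring, Real.Gamma_add_one (sub_pos.2 hκ₁).ne', hsum', hsum,
    Real.Gamma_add_one hp.ne']
  field_simp

end ClosedForm

section SupercriticalEdge

variable {ι : Type*} {l : Filter ι} {ε s c : ι → ℝ} {h : ℝ → ℝ} {κ C R s₀ c₀ u : ℝ}

lemma rpow_sub_one_eq_sq_mul (hu : 0 < u) : u ^ (κ - 1) = u ^ 2 * u ^ (κ - 3) := by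
  rw [← Real.rpow_two, ← Real.rpow_add hu]
  ring_nf

lemma EdgeBound.apply_sub_le_rpow {ε : ℝ} (hb : EdgeBound h κ C R) (hκ : 1 ≤ κ) (hε : 0 ≤ ε)
    (hu : u ∈ Ioo 0 R) : h (u - ε) ≤ C * u ^ (κ - 1) := by
  have hC := hb.const_nonneg (hu.1.trans hu.2)
  rcases le_or_gt u ε with huε | huε
  · rw [hb.eq_zero _ (sub_nonpos.2 huε)]
    exact mul_nonneg hC (Real.rpow_nonneg hu.1.le _)
  · have hsub : u - ε ≤ u := sub_le_self u hε
    refine (hb.le_rpow _ ⟨sub_pos.2 huε, hsub.trans_lt hu.2⟩).trans ?_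
    gcongr

lemma EdgeBound.amgmGap_le_rpow {s ε : ℝ} (hb : EdgeBound h κ C R) (hκ : 1 ≤ κ)
    (hs : s ∈ Icc (0 : ℝ) 1) (hε : 0 < ε) (hu : u ∈ Ioo 0 R) :
    amgmGap s (h u) (h (u - ε)) ≤ (8 * C + 4 * C ^ 3 * Real.exp C) * u ^ (κ - 3) * ε ^ 2 := by
  have hC := hb.const_nonneg (hu.1.trans hu.2)
  have hpos : 0 < u ^ (κ - 3) := Real.rpow_pos_of_pos hu.1 _
  have hpow := rpow_sub_one_eq_sq_mul (κ := κ) hu.1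
  have hle := hb.le_rpow u hu
  rcases le_or_gt (2 * ε) u with hfar | hnear
  · calc amgmGap s (h u) (h (u - ε))
        ≤ 4 * C ^ 2 * Real.exp C * (ε / u) ^ 2 * h u :=
          hb.amgmGap_le_of_two_mul_le hs hε hfar hu.2
      _ ≤ 4 * C ^ 2 * Real.exp C * (ε / u) ^ 2 * (C * u ^ (κ - 1)) := by gcongr
      _ = 4 * C ^ 3 * Real.exp C * u ^ (κ - 3) * ε ^ 2 := by
          have := hu.1.ne'
          rw [hpow]
          field_simp
      _ ≤ (8 * C + 4 * C ^ 3 * Real.exp C) * u ^ (κ - 3) * ε ^ 2 := by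
          gcongr
          exact le_add_of_nonneg_left (by positivity)
  · have hle' := hb.apply_sub_le_rpow hκ hε.le hu
    calc amgmGap s (h u) (h (u - ε)) ≤ h u + h (u - ε) :=
          amgmGap_le_add hs (hb.nonneg _) (hb.nonneg _)
      _ ≤ 2 * C * u ^ (κ - 3) * u ^ 2 := by
          rw [hpow] at hle hle'
          linarith
      _ ≤ 2 * C * u ^ (κ - 3) * (2 * ε) ^ 2 := by
          gcongr
          exact hu.1.le
      _ = 8 * C * u ^ (κ - 3) * ε ^ 2 := by ring
      _ ≤ (8 * C + 4 * C ^ 3 * Real.exp C) * u ^ (κ - 3) * ε ^ 2 := by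
          gcongr
          exact le_add_of_nonneg_right (by positivity)

lemma tendsto_amgmGap_div_sq (hd : DifferentiableAt ℝ h u) (hu : 0 < h u)
    (hε : Tendsto ε l (𝓝[>] 0)) (hs : Tendsto s l (𝓝[Ioo 0 1] s₀)) :
    Tendsto (fun i => (ε i ^ 2)⁻¹ * amgmGap (s i) (h u) (h (u - ε i))) l
      (𝓝 (s₀ * (1 - s₀) / 2 * ((h u)⁻¹ * deriv h u ^ 2))) := by
  have hneg : Tendsto (fun i => -ε i) l (𝓝[≠] 0) := by
    refine tendsto_nhdsWithin_iff.2 ⟨?_, ?_⟩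
    · simpa using (tendsto_nhds_of_tendsto_nhdsWithin hε).neg
    · filter_upwards [hε.eventually self_mem_nhdsWithin] with i hi
      exact neg_ne_zero.2 (ne_of_gt hi)
  have hshift : Tendsto (fun i => u - ε i) l (𝓝 u) := by
    simpa using (tendsto_nhds_of_tendsto_nhdsWithin hε).const_sub u
  have hq := hd.continuousAt.tendsto.comp hshift
  have hslope := (hasDerivAt_iff_tendsto_slope_zero.1 (hd.hasDerivAt.log hu.ne')).comp hneg
  refine tendsto_mul_amgmGap hs (.of_forall fun _ => hu) (hq.eventually (lt_mem_nhds hu)) ?_ ?_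
  · simpa using ((Real.continuousAt_log hu.ne').tendsto.comp hq).sub_const (Real.log (h u))
  · have hfisher : h u * (deriv h u / h u) ^ 2 = (h u)⁻¹ * deriv h u ^ 2 := by field_simp
    refine (hfisher ▸ (hslope.pow 2).const_mul (h u)).congr fun i => ?_
    simp only [Function.comp_apply, smul_eq_mul, ← sub_eq_add_neg, mul_pow, inv_pow, neg_sq]
    ring

lemma integrableOn_rpow_sub_three (hκ : 2 < κ) (R : ℝ) :
    IntegrableOn (fun u : ℝ => u ^ (κ - 3)) (Ioo 0 R) := by
  rcases le_total R 0 with hR | hR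
  · simp [Ioo_eq_empty hR.not_gt]
  · exact (intervalIntegrable_iff_integrableOn_Ioo_of_le hR).1
      (intervalIntegral.intervalIntegrable_rpow' (by linarith))

lemma EdgeBound.integrableOn_inv_mul_deriv_sq (hb : EdgeBound h κ C R) (hκ : 2 < κ) :
    IntegrableOn (fun u => (h u)⁻¹ * deriv h u ^ 2) (Ioo 0 R) := by
  refine ((integrableOn_rpow_sub_three hκ R).const_mul (C ^ 3)).mono'
    (hb.measurable.inv.mul ((measurable_deriv h).pow_const 2)).aestronglyMeasurable ?_
  filter_upwards [ae_restrict_mem measurableSet_Ioo] with u hu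
  have hpos := hb.pos u hu
  have hC := hb.const_nonneg (hu.1.trans hu.2)
  have hpow := rpow_sub_one_eq_sq_mul (κ := κ) hu.1
  rw [Real.norm_of_nonneg (by positivity)]
  calc (h u)⁻¹ * deriv h u ^ 2 = h u * |logDeriv h u| ^ 2 := by
        rw [sq_abs, logDeriv_apply]
        field_simp
    _ ≤ (C * u ^ (κ - 1)) * (C / u) ^ 2 := by
        gcongr
        · exact mul_nonneg hC (Real.rpow_nonneg hu.1.le _)
        · exact hb.le_rpow u hu
        · exact hb.abs_logDeriv_le u hu
    _ = C ^ 3 * u ^ (κ - 3) := by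
        have := hu.1.ne'
        rw [hpow]
        field_simp

lemma tendsto_indicator_Iic {F : ι → ℝ → ℝ} {G : ℝ → ℝ} (hc : Tendsto c l (𝓝 c₀)) (hu : u ≠ c₀)
    (hF : Tendsto (fun i => F i u) l (𝓝 (G u))) :
    Tendsto (fun i => (Iic (c i)).indicator (F i) u) l (𝓝 ((Iic c₀).indicator G u)) := by
  rcases hu.lt_or_gt with huc | huc
  · rw [indicator_of_mem (mem_Iic.2 huc.le)]
    refine hF.congr' ?_
    filter_upwards [hc.eventually_const_lt huc] with i hi
    rw [indicator_of_mem (mem_Iic.2 hi.le)]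
  · rw [indicator_of_notMem (notMem_Iic.2 huc)]
    refine tendsto_const_nhds.congr' ?_
    filter_upwards [hc.eventually_lt_const huc] with i hi
    rw [indicator_of_notMem (notMem_Iic.2 hi)]

lemma EdgeBound.tendsto_edgeInt_div_sq [l.IsCountablyGenerated] (hb : EdgeBound h κ C R)
    (hκ : 2 < κ) (hε : Tendsto ε l (𝓝[>] 0)) (hs : Tendsto s l (𝓝[Ioo 0 1] s₀))
    (hc : Tendsto c l (𝓝 c₀)) (hc₀R : c₀ < R) :
    Tendsto (fun i => edgeInt h (c i) (ε i) (s i) / ε i ^ 2) l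
      (𝓝 (s₀ * (1 - s₀) / 2 * ∫ u in Ioc 0 c₀, (h u)⁻¹ * deriv h u ^ 2)) := by
  have hεpos : ∀ᶠ i in l, 0 < ε i := hε.eventually self_mem_nhdsWithin
  have hcut : ∀ {x}, x < R → Ioo 0 R ∩ Iic x = Ioc 0 x := fun hx =>
    Set.ext fun u => ⟨fun hu => ⟨hu.1.1, hu.2⟩, fun hu => ⟨⟨hu.1, hu.2.trans_lt hx⟩, hu.2⟩⟩
  suffices hdom : Tendsto (fun i => ∫ u in Ioo 0 R, (Iic (c i)).indicator
      (fun u => (ε i ^ 2)⁻¹ * amgmGap (s i) (h u) (h (u - ε i))) u) l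
      (𝓝 (∫ u in Ioo 0 R, (Iic c₀).indicator
        (fun u => s₀ * (1 - s₀) / 2 * ((h u)⁻¹ * deriv h u ^ 2)) u)) by
    rw [setIntegral_indicator measurableSet_Iic, hcut hc₀R, integral_const_mul] at hdom
    refine hdom.congr' ?_
    filter_upwards [hc.eventually_lt_const hc₀R] with i hi
    rw [setIntegral_indicator measurableSet_Iic, hcut hi, integral_const_mul, inv_mul_eq_div,
      edgeInt]
  refine tendsto_integral_filter_of_dominated_convergence
    (fun u => (8 * C + 4 * C ^ 3 * Real.exp C) * u ^ (κ - 3)) ?_ ?_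
    ((integrableOn_rpow_sub_three hκ R).const_mul _) ?_
  · exact .of_forall fun i => (((measurable_amgmGap _ hb.measurable (hb.measurable.comp
      (measurable_sub_const _))).const_mul _).indicator measurableSet_Iic).aestronglyMeasurable
  · filter_upwards [hεpos, hs.eventually self_mem_nhdsWithin] with i hεi hsi
    filter_upwards [ae_restrict_mem measurableSet_Ioo] with u hu
    have hs' := Ioo_subset_Icc_self hsi
    refine (norm_indicator_le_norm_self _ _).trans ?_
    rw [Real.norm_of_nonneg (mul_nonneg (by positivity)
      (amgmGap_nonneg hs' (hb.nonneg _) (hb.nonneg _))), inv_mul_le_iff₀' (by positivity)]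
    exact hb.amgmGap_le_rpow (by linarith) hs' hεi hu
  · filter_upwards [ae_restrict_mem measurableSet_Ioo,
      ae_restrict_of_ae (Measure.ae_ne volume c₀)] with u hu hne
    exact tendsto_indicator_Iic hc hne
      (tendsto_amgmGap_div_sq (hb.differentiableAt hu) (hb.pos u hu) hε hs)

end SupercriticalEdge

section CriticalEdge

variable {ι : Type*} {l : Filter ι} {ε s c u : ι → ℝ} {h : ℝ → ℝ} {A C R s₀ c₀ : ℝ}

lemma RegularEndpoint.tendsto_div_self (hreg : RegularEndpoint h 2 A) :
    Tendsto (fun u => h u / u) (𝓝[>] 0) (𝓝 A) :=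
  hreg.tendsto_div_rpow.congr fun u => by norm_num

lemma RegularEndpoint.tendsto_mul_logDeriv (hreg : RegularEndpoint h 2 A) (hA : A ≠ 0) :
    Tendsto (fun u => u * logDeriv h u) (𝓝[>] 0) (𝓝 1) := by
  refine (div_self hA ▸ (hreg.tendsto_deriv rfl).div hreg.tendsto_div_self hA).congr fun u => ?_
  rw [Pi.div_apply, logDeriv_apply, div_div_eq_mul_div, mul_comm, mul_div_assoc]

lemma EdgeProfile.exists_log_sub_log_eq {ε u : ℝ} (hp : EdgeProfile h R) (hε : 0 < ε)
    (hεu : ε < u) (huR : u < R) : ∃ ξ ∈ Ioo (u - ε) u,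
      Real.log (h (u - ε)) - Real.log (h u) = -(ε * logDeriv h ξ) := by
  have hmem : ∀ x ∈ Icc (u - ε) u, x ∈ Ioo 0 R := fun x hx =>
    ⟨(sub_pos.2 hεu).trans_le hx.1, hx.2.trans_lt huR⟩
  have hlog : ∀ x ∈ Icc (u - ε) u,
      HasDerivAt (fun x => Real.log (h x)) (logDeriv h x) x := fun x hx =>
    (hp.differentiableAt (hmem x hx)).hasDerivAt.log (hp.pos x (hmem x hx)).ne'
  obtain ⟨ξ, hξ, hslope⟩ := exists_hasDerivAt_eq_slope (fun x => Real.log (h x)) (logDeriv h)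
    (sub_lt_self u hε) (fun x hx => (hlog x hx).continuousAt.continuousWithinAt)
    (fun x hx => hlog x (Ioo_subset_Icc_self hx))
  refine ⟨ξ, hξ, ?_⟩
  rw [hslope, sub_sub_cancel, mul_div_cancel₀ _ hε.ne', neg_sub]

lemma eventually_lt_of_tendsto_div_zero (hu : ∀ᶠ i in l, 0 < u i)
    (hεu : Tendsto (fun i => ε i / u i) l (𝓝 0)) {k : ℝ} (hk : 0 < k) :
    ∀ᶠ i in l, k * ε i < u i := by
  filter_upwards [hεu.eventually_lt_const (inv_pos.2 hk), hu] with i hi hui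
  rwa [div_lt_iff₀ hui, lt_inv_mul_iff₀ hk] at hi

lemma EdgeProfile.tendsto_div_mul_log_sub_log (hp : EdgeProfile h R) (hR : 0 < R)
    (hlogDeriv : Tendsto (fun u => u * logDeriv h u) (𝓝[>] 0) (𝓝 1))
    (hu : Tendsto u l (𝓝[>] 0)) (hε : ∀ᶠ i in l, 0 < ε i)
    (hεu : Tendsto (fun i => ε i / u i) l (𝓝 0)) :
    Tendsto (fun i => u i / ε i * (Real.log (h (u i - ε i)) - Real.log (h (u i)))) l
      (𝓝 (-1)) := by
  have hu₀ : ∀ᶠ i in l, 0 < u i := hu.eventually self_mem_nhdsWithin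
  have hu' := tendsto_nhds_of_tendsto_nhdsWithin hu
  have hlt := eventually_lt_of_tendsto_div_zero hu₀ hεu one_pos
  have hmvt : ∀ᶠ i in l, ∃ ξ, ξ ∈ Ioo (u i - ε i) (u i) ∧
      Real.log (h (u i - ε i)) - Real.log (h (u i)) = -(ε i * logDeriv h ξ) := by
    filter_upwards [hε, hu'.eventually_lt_const hR, hlt] with i hεi huR hlti
    exact hp.exists_log_sub_log_eq hεi (by rwa [one_mul] at hlti) huR
  obtain ⟨ξ, hξ⟩ := skolem.1 hmvt
  have hξ₀ : ∀ᶠ i in l, 0 < ξ i := by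
    filter_upwards [hξ, hlt] with i hi hlti
    linarith [hi.1.1]
  have hξ_lim : Tendsto ξ l (𝓝[>] 0) := by
    refine tendsto_nhdsWithin_iff.2 ⟨squeeze_zero' (hξ₀.mono fun _ => le_of_lt) ?_ hu', hξ₀⟩
    exact hξ.mono fun i hi => hi.1.2.le
  have hratio : Tendsto (fun i => ξ i / u i) l (𝓝 1) := by
    refine tendsto_of_tendsto_of_tendsto_of_le_of_le' (by simpa using hεu.const_sub 1)
      tendsto_const_nhds ?_ ?_
    · filter_upwards [hξ, hu₀] with i hi hui
      rw [le_div_iff₀ hui, sub_mul, div_mul_cancel₀ _ hui.ne', one_mul]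
      exact hi.1.1.le
    · filter_upwards [hξ, hu₀] with i hi hui using (div_le_one hui).2 hi.1.2.le
  have hlim := ((hratio.inv₀ one_ne_zero).mul (hlogDeriv.comp hξ_lim)).neg
  rw [inv_one, one_mul] at hlim
  refine hlim.congr' ?_
  filter_upwards [hξ, hξ₀, hε] with i hi hξi hεi
  rw [hi.2, Function.comp_apply]
  field_simp

lemma EdgeProfile.tendsto_div_sq_mul_amgmGap_of_ne_zero (hp : EdgeProfile h R) (hR : 0 < R)
    (hreg : RegularEndpoint h 2 A) (hA : A ≠ 0) (hu : Tendsto u l (𝓝[>] 0))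
    (hε : ∀ᶠ i in l, 0 < ε i) (hεu : Tendsto (fun i => ε i / u i) l (𝓝 0))
    (hs : Tendsto s l (𝓝[Ioo 0 1] s₀)) :
    Tendsto (fun i => u i / ε i ^ 2 * amgmGap (s i) (h (u i)) (h (u i - ε i))) l
      (𝓝 (s₀ * (1 - s₀) / 2 * A)) := by
  have hu₀ : ∀ᶠ i in l, 0 < u i := hu.eventually self_mem_nhdsWithin
  have huR := (tendsto_nhds_of_tendsto_nhdsWithin hu).eventually_lt_const hR
  have hlog := hp.tendsto_div_mul_log_sub_log hR (hreg.tendsto_mul_logDeriv hA) hu hε hεu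
  refine tendsto_mul_amgmGap hs ?_ ?_ ?_ ?_
  · filter_upwards [hu₀, huR] with i hi hiR using hp.pos _ ⟨hi, hiR⟩
  · filter_upwards [eventually_lt_of_tendsto_div_zero hu₀ hεu one_pos, huR, hε] with i hi hiR hεi
    exact hp.pos _ ⟨by linarith, by linarith⟩
  · refine (zero_mul (-1 : ℝ) ▸ hεu.mul hlog).congr' ?_
    filter_upwards [hu₀, hε] with i hi hεi
    field_simp
  · have hmain := (hreg.tendsto_div_self.comp hu).mul (hlog.pow 2)
    rw [neg_one_sq, mul_one] at hmain
    refine hmain.congr' ?_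
    filter_upwards [hu₀, hε] with i hi hεi
    rw [Function.comp_apply]
    field_simp

lemma EdgeBound.tendsto_div_sq_mul_amgmGap_of_eq_zero (hb : EdgeBound h 2 C R) (hR : 0 < R)
    (hreg : RegularEndpoint h 2 0) (hu : Tendsto u l (𝓝[>] 0))
    (hε : ∀ᶠ i in l, 0 < ε i) (hεu : Tendsto (fun i => ε i / u i) l (𝓝 0))
    (hs : ∀ᶠ i in l, s i ∈ Ioo (0 : ℝ) 1) :
    Tendsto (fun i => u i / ε i ^ 2 * amgmGap (s i) (h (u i)) (h (u i - ε i))) l (𝓝 0) := by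
  have hu₀ : ∀ᶠ i in l, 0 < u i := hu.eventually self_mem_nhdsWithin
  have hmajor : Tendsto (fun i => 4 * C ^ 2 * Real.exp C * (h (u i) / u i)) l (𝓝 0) :=
    mul_zero (4 * C ^ 2 * Real.exp C) ▸ (hreg.tendsto_div_self.comp hu).const_mul _
  refine squeeze_zero' ?_ ?_ hmajor
  · filter_upwards [hu₀, hs] with i hi hsi
    have := amgmGap_nonneg (Ioo_subset_Icc_self hsi) (hb.nonneg (u i)) (hb.nonneg (u i - ε i))
    positivity
  · filter_upwards [hu₀, hs, hε, eventually_lt_of_tendsto_div_zero hu₀ hεu two_pos,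
      (tendsto_nhds_of_tendsto_nhdsWithin hu).eventually_lt_const hR] with i hi hsi hεi h2 hiR
    calc u i / ε i ^ 2 * amgmGap (s i) (h (u i)) (h (u i - ε i))
        ≤ u i / ε i ^ 2 * (4 * C ^ 2 * Real.exp C * (ε i / u i) ^ 2 * h (u i)) := by
          gcongr
          exact hb.amgmGap_le_of_two_mul_le (Ioo_subset_Icc_self hsi) hεi h2.le hiR
      _ = 4 * C ^ 2 * Real.exp C * (h (u i) / u i) := by field_simp

lemma EdgeBound.tendsto_div_sq_mul_amgmGap (hb : EdgeBound h 2 C R) (hR : 0 < R)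
    (hreg : RegularEndpoint h 2 A) (hu : Tendsto u l (𝓝[>] 0))
    (hε : ∀ᶠ i in l, 0 < ε i) (hεu : Tendsto (fun i => ε i / u i) l (𝓝 0))
    (hs : Tendsto s l (𝓝[Ioo 0 1] s₀)) :
    Tendsto (fun i => u i / ε i ^ 2 * amgmGap (s i) (h (u i)) (h (u i - ε i))) l
      (𝓝 (s₀ * (1 - s₀) / 2 * A)) := by
  rcases eq_or_ne A 0 with rfl | hA
  · simpa only [mul_zero] using hb.tendsto_div_sq_mul_amgmGap_of_eq_zero hR hreg hu hε hεu
      (hs.eventually self_mem_nhdsWithin)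
  · exact hb.toEdgeProfile.tendsto_div_sq_mul_amgmGap_of_ne_zero hR hreg hA hu hε hεu hs

lemma integral_Ioi_eq_integral_const_rpow {ε : ℝ} (hε : 0 < ε) (hε₁ : ε < 1) (g : ℝ → ℝ) :
    ∫ u in Ioi 0, g u = ∫ τ : ℝ, ε ^ τ * -Real.log ε * g (ε ^ τ) := by
  have himage : (fun τ : ℝ => ε ^ τ) '' univ = Ioi 0 := by
    refine image_univ.trans (subset_antisymm ?_ fun u hu => ?_)
    · exact range_subset_iff.2 fun τ => Real.rpow_pos_of_pos hε τ
    · exact ⟨Real.logb ε u, Real.rpow_logb hε hε₁.ne hu⟩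
  rw [← himage, integral_image_eq_integral_abs_deriv_smul MeasurableSet.univ
    (fun τ _ => (Real.hasStrictDerivAt_const_rpow hε τ).hasDerivAt.hasDerivWithinAt)
    ((Real.strictAnti_rpow_of_base_lt_one hε hε₁).injective.injOn), setIntegral_univ]
  congr 1 with τ
  rw [abs_mul, abs_of_pos (Real.rpow_pos_of_pos hε τ), abs_of_neg (Real.log_neg hε hε₁),
    smul_eq_mul]

lemma setIntegral_Ioc_div_neg_log {ε c : ℝ} (hε : 0 < ε) (hε₁ : ε < 1) (g : ℝ → ℝ) :
    (∫ u in Ioc ε c, g u) / -Real.log ε =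
      ∫ τ : ℝ, (Ioc ε c).indicator (fun u => u * g u) (ε ^ τ) := by
  have hsub : Ioi 0 ∩ Ioc ε c = Ioc ε c := inter_eq_right.2 fun u hu => hε.trans hu.1
  have hlog := (Real.log_neg hε hε₁).ne
  rw [← hsub, ← setIntegral_indicator measurableSet_Ioc, hsub,
    integral_Ioi_eq_integral_const_rpow hε hε₁, div_eq_inv_mul, ← integral_const_mul]
  congr 1 with τ
  by_cases hτ : ε ^ τ ∈ Ioc ε c
  · rw [indicator_of_mem hτ, indicator_of_mem hτ]
    field_simp
  · rw [indicator_of_notMem hτ, indicator_of_notMem hτ, mul_zero, mul_zero]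

lemma eventually_rpow_mem_Ioc (hε : Tendsto ε l (𝓝[>] 0)) (hc : Tendsto c l (𝓝 c₀))
    (hc₀ : 0 < c₀) {τ : ℝ} (hτ : τ ∈ Ioo (0 : ℝ) 1) : ∀ᶠ i in l, ε i ^ τ ∈ Ioc (ε i) (c i) := by
  have hpow := tendsto_nhds_of_tendsto_nhdsWithin ((tendsto_rpow_nhdsGT_zero hτ.1).comp hε)
  filter_upwards [hε.eventually (Ioo_mem_nhdsGT one_pos), hpow.eventually_lt hc hc₀] with i hi hlt
  exact ⟨Real.self_lt_rpow_of_lt_one hi.1 hi.2 hτ.2, hlt.le⟩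

lemma abs_le_one_of_rpow_mem_Ioc {ε c τ : ℝ} (hε : 0 < ε) (hε₁ : ε < 1) (hc : c ≤ ε⁻¹)
    (hτ : ε ^ τ ∈ Ioc ε c) : τ ∈ Icc (-1 : ℝ) 1 := by
  rw [← Real.rpow_neg_one] at hc
  exact ⟨(Real.rpow_le_rpow_left_iff_of_base_lt_one hε hε₁).1 (hτ.2.trans hc),
    ((Real.rpow_lt_rpow_left_iff_of_base_lt_one hε hε₁).1 ((Real.rpow_one ε).symm ▸ hτ.1)).le⟩

lemma eventually_rpow_notMem_Ioc (hε : Tendsto ε l (𝓝[>] 0)) (hc : Tendsto c l (𝓝 c₀))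
    {τ : ℝ} (hτ : τ < 0 ∨ 1 < τ) : ∀ᶠ i in l, ε i ^ τ ∉ Ioc (ε i) (c i) := by
  rcases hτ with hτ | hτ
  · have hpow := (tendsto_rpow_neg_nhdsGT_zero hτ).comp hε
    filter_upwards [hpow.eventually_gt_atTop (c₀ + 1),
      hc.eventually_lt_const (lt_add_one c₀)] with i hpi hci hmem
    exact (hci.trans hpi).not_ge hmem.2
  · filter_upwards [hε.eventually (Ioo_mem_nhdsGT one_pos)] with i hi hmem
    exact (Real.rpow_lt_self_of_lt_one hi.1 hi.2 hτ).not_gt hmem.1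

lemma tendsto_setIntegral_Ioc_div_neg_log [l.IsCountablyGenerated] {g : ι → ℝ → ℝ} {B K : ℝ}
    (hε : Tendsto ε l (𝓝[>] 0)) (hc : Tendsto c l (𝓝 c₀)) (hc₀ : 0 < c₀)
    (hg : ∀ i, Measurable (g i)) (hK : ∀ᶠ i in l, ∀ u ∈ Ioc (ε i) (c i), |u * g i u| ≤ K)
    (hlim : ∀ τ ∈ Ioo (0 : ℝ) 1, Tendsto (fun i => ε i ^ τ * g i (ε i ^ τ)) l (𝓝 B)) :
    Tendsto (fun i => (∫ u in Ioc (ε i) (c i), g i u) / -Real.log (ε i)) l (𝓝 B) := by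
  have hε₁ : ∀ᶠ i in l, ε i ∈ Ioo (0 : ℝ) 1 := hε.eventually (Ioo_mem_nhdsGT one_pos)
  have hB : ∫ τ, (Ioo (0 : ℝ) 1).indicator (fun _ => B) τ = B := by
    simp [integral_indicator measurableSet_Ioo]
  suffices hdom : Tendsto (fun i => ∫ τ : ℝ, (Ioc (ε i) (c i)).indicator (fun u => u * g i u)
      (ε i ^ τ)) l (𝓝 (∫ τ, (Ioo (0 : ℝ) 1).indicator (fun _ => B) τ)) by
    refine (hB ▸ hdom).congr' ?_
    filter_upwards [hε₁] with i hi using (setIntegral_Ioc_div_neg_log hi.1 hi.2 (g i)).symm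
  refine tendsto_integral_filter_of_dominated_convergence
    ((Icc (-1 : ℝ) 1).indicator fun _ => |K|) ?_ ?_
    ((integrable_indicator_iff measurableSet_Icc).2 (by simp)) ?_
  · exact .of_forall fun i => (((measurable_id.mul (hg i)).indicator measurableSet_Ioc).comp
      (by fun_prop)).aestronglyMeasurable
  · have hcε : ∀ᶠ i in l, c i ≤ (ε i)⁻¹ :=
      ((hc.eventually_lt_const (lt_add_one c₀)).and
        ((tendsto_inv_nhdsGT_zero.comp hε).eventually_gt_atTop (c₀ + 1))).mono
        fun i hi => (hi.1.trans hi.2).le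
    filter_upwards [hε₁, hcε, hK] with i hi hci hKi
    refine .of_forall fun τ => ?_
    by_cases hτ : ε i ^ τ ∈ Ioc (ε i) (c i)
    · rw [indicator_of_mem hτ,
        indicator_of_mem (abs_le_one_of_rpow_mem_Ioc hi.1 hi.2 hci hτ)]
      exact (hKi _ hτ).trans (le_abs_self K)
    · rw [indicator_of_notMem hτ, norm_zero]
      exact indicator_nonneg (fun _ _ => abs_nonneg K) τ
  · filter_upwards [Measure.ae_ne volume 0, Measure.ae_ne volume 1] with τ hτ₀ hτ₁
    by_cases hτ : τ ∈ Ioo (0 : ℝ) 1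
    · rw [indicator_of_mem hτ]
      refine (hlim τ hτ).congr' ?_
      filter_upwards [eventually_rpow_mem_Ioc hε hc hc₀ hτ] with i hi
      rw [indicator_of_mem hi]
    · have hout : τ < 0 ∨ 1 < τ := by grind
      rw [indicator_of_notMem hτ]
      refine tendsto_const_nhds.congr' ?_
      filter_upwards [eventually_rpow_notMem_Ioc hε hc hout] with i hi
      rw [indicator_of_notMem hi]

lemma EdgeBound.setIntegral_Ioc_amgmGap_le {s ε : ℝ} (hb : EdgeBound h 2 C R)
    (hs : s ∈ Icc (0 : ℝ) 1) (hε : 0 < ε) (hεR : ε < R) :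
    ∫ u in Ioc 0 ε, amgmGap s (h u) (h (u - ε)) ≤ C * ε ^ 2 := by
  have hbound : ∀ u ∈ Ioc 0 ε, ‖amgmGap s (h u) (h (u - ε))‖ ≤ C * ε := fun u hu => by
    have hC := hb.const_nonneg (hε.trans hεR)
    rw [Real.norm_of_nonneg (amgmGap_nonneg hs (hb.nonneg _) (hb.nonneg _))]
    calc amgmGap s (h u) (h (u - ε)) ≤ h u + h (u - ε) :=
          amgmGap_le_add hs (hb.nonneg _) (hb.nonneg _)
      _ = h u := by rw [hb.eq_zero _ (sub_nonpos.2 hu.2), add_zero]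
      _ ≤ C * u ^ ((2 : ℝ) - 1) := hb.le_rpow u ⟨hu.1, hu.2.trans_lt hεR⟩
      _ ≤ C * ε := by
          rw [show (2 : ℝ) - 1 = 1 by norm_num, Real.rpow_one]
          exact mul_le_mul_of_nonneg_left hu.2 hC
  calc ∫ u in Ioc 0 ε, amgmGap s (h u) (h (u - ε))
      ≤ C * ε * volume.real (Ioc 0 ε) :=
        (le_abs_self _).trans (norm_setIntegral_le_of_norm_le_const measure_Ioc_lt_top hbound)
    _ = C * ε ^ 2 := by
        rw [Real.volume_real_Ioc_of_le hε.le]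
        ring

lemma EdgeBound.tendsto_setIntegral_Ioc_amgmGap (hb : EdgeBound h 2 C R) (hR : 0 < R)
    (hε : Tendsto ε l (𝓝[>] 0)) (hs : ∀ᶠ i in l, s i ∈ Ioo (0 : ℝ) 1) :
    Tendsto (fun i => (∫ u in Ioc 0 (ε i), amgmGap (s i) (h u) (h (u - ε i))) /
      (-ε i ^ 2 * Real.log (ε i))) l (𝓝 0) := by
  have hlog : Tendsto (fun i => C / -Real.log (ε i)) l (𝓝 0) :=
    (tendsto_neg_atBot_atTop.comp (Real.tendsto_log_nhdsGT_zero.comp hε)).const_div_atTop C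
  refine squeeze_zero' ?_ ?_ hlog
  all_goals
    filter_upwards [hε.eventually (Ioo_mem_nhdsGT one_pos), hε.eventually (Ioo_mem_nhdsGT hR), hs]
      with i hi hiR hsi
    have hlogi := Real.log_neg hi.1 hi.2
    have hden : 0 < -ε i ^ 2 * Real.log (ε i) := by nlinarith [pow_pos hi.1 2]
  · exact div_nonneg (integral_nonneg fun u => amgmGap_nonneg (Ioo_subset_Icc_self hsi)
      (hb.nonneg _) (hb.nonneg _)) hden.le
  · calc (∫ u in Ioc 0 (ε i), amgmGap (s i) (h u) (h (u - ε i))) / (-ε i ^ 2 * Real.log (ε i))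
        ≤ C * ε i ^ 2 / (-ε i ^ 2 * Real.log (ε i)) := by
          gcongr
          exact hb.setIntegral_Ioc_amgmGap_le (Ioo_subset_Icc_self hsi) hi.1 hiR.2
      _ = C / -Real.log (ε i) := by
          have := hi.1.ne'
          have := hlogi.ne
          field_simp

lemma EdgeBound.integrableOn_amgmGap {s ε c : ℝ} (hb : EdgeBound h 2 C R)
    (hs : s ∈ Icc (0 : ℝ) 1) (hε : 0 < ε) (hcR : c < R) :
    IntegrableOn (fun u => amgmGap s (h u) (h (u - ε))) (Ioc 0 c) := by
  have hbound : ∀ u ∈ Ioc 0 c, ∀ v ≤ u, h v ≤ C * R := fun u hu v hv => by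
    have hC := hb.const_nonneg (hu.1.trans_le (hu.2.trans hcR.le))
    rcases le_or_gt v 0 with hv₀ | hv₀
    · rw [hb.eq_zero v hv₀]
      exact mul_nonneg hC (hu.1.le.trans (hu.2.trans hcR.le))
    · have hvR : v < R := hv.trans_lt (hu.2.trans_lt hcR)
      refine (hb.le_rpow v ⟨hv₀, hvR⟩).trans ?_
      rw [show (2 : ℝ) - 1 = 1 by norm_num, Real.rpow_one]
      exact mul_le_mul_of_nonneg_left hvR.le hC
  refine Measure.integrableOn_of_bounded measure_Ioc_lt_top.ne (measurable_amgmGap s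
    hb.measurable (hb.measurable.comp (measurable_sub_const ε))).aestronglyMeasurable
    (M := C * R + C * R) ?_
  filter_upwards [ae_restrict_mem measurableSet_Ioc] with u hu
  rw [Real.norm_of_nonneg (amgmGap_nonneg hs (hb.nonneg _) (hb.nonneg _))]
  exact (amgmGap_le_add hs (hb.nonneg _) (hb.nonneg _)).trans
    (add_le_add (hbound u hu u le_rfl) (hbound u hu _ (sub_le_self u hε.le)))

lemma EdgeBound.mul_amgmGap_div_sq_le {s ε u : ℝ} (hb : EdgeBound h 2 C R)
    (hs : s ∈ Icc (0 : ℝ) 1) (hε : 0 < ε) (hu : u ∈ Ioo 0 R) :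
    |u * (amgmGap s (h u) (h (u - ε)) / ε ^ 2)| ≤ 8 * C + 4 * C ^ 3 * Real.exp C := by
  have hu₀ := hu.1
  have hgap := amgmGap_nonneg hs (hb.nonneg u) (hb.nonneg (u - ε))
  rw [abs_of_nonneg (by positivity)]
  calc u * (amgmGap s (h u) (h (u - ε)) / ε ^ 2)
      ≤ u * ((8 * C + 4 * C ^ 3 * Real.exp C) * u ^ ((2 : ℝ) - 3) * ε ^ 2 / ε ^ 2) := by
        gcongr
        exact hb.amgmGap_le_rpow one_le_two hs hε hu
    _ = 8 * C + 4 * C ^ 3 * Real.exp C := by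
        rw [show (2 : ℝ) - 3 = -1 by norm_num, Real.rpow_neg_one]
        field_simp

lemma EdgeBound.tendsto_setIntegral_Ioc_amgmGap_of_pos [l.IsCountablyGenerated]
    (hb : EdgeBound h 2 C R) (hreg : RegularEndpoint h 2 A) (hε : Tendsto ε l (𝓝[>] 0))
    (hs : Tendsto s l (𝓝[Ioo 0 1] s₀)) (hc : Tendsto c l (𝓝 c₀)) (hc₀ : 0 < c₀) (hc₀R : c₀ < R) :
    Tendsto (fun i => (∫ u in Ioc (ε i) (c i), amgmGap (s i) (h u) (h (u - ε i))) /
      (-ε i ^ 2 * Real.log (ε i))) l (𝓝 (s₀ * (1 - s₀) / 2 * A)) := by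
  have hεpos : ∀ᶠ i in l, 0 < ε i := hε.eventually self_mem_nhdsWithin
  have hscale := tendsto_setIntegral_Ioc_div_neg_log (B := s₀ * (1 - s₀) / 2 * A)
    (K := 8 * C + 4 * C ^ 3 * Real.exp C)
    (g := fun i u => amgmGap (s i) (h u) (h (u - ε i)) / ε i ^ 2) hε hc hc₀ ?_ ?_ ?_
  · refine hscale.congr fun i => ?_
    rw [integral_div, div_div, mul_neg, neg_mul]
  · exact fun i => (measurable_amgmGap _ hb.measurable (hb.measurable.comp
      (measurable_sub_const _))).div_const _
  · filter_upwards [hεpos, hs.eventually self_mem_nhdsWithin,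
      hc.eventually_lt_const hc₀R] with i hεi hsi hci u hu
    exact hb.mul_amgmGap_div_sq_le (Ioo_subset_Icc_self hsi) hεi
      ⟨hεi.trans hu.1, hu.2.trans_lt hci⟩
  · intro τ hτ
    have hratio : Tendsto (fun i => ε i / ε i ^ τ) l (𝓝 0) := by
      refine (tendsto_nhds_of_tendsto_nhdsWithin
        ((tendsto_rpow_nhdsGT_zero (sub_pos.2 hτ.2)).comp hε)).congr' ?_
      filter_upwards [hεpos] with i hi
      rw [Function.comp_apply, Real.rpow_sub hi, Real.rpow_one]
    refine (hb.tendsto_div_sq_mul_amgmGap (hc₀.trans hc₀R) hreg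
      ((tendsto_rpow_nhdsGT_zero hτ.1).comp hε) hεpos hratio hs).congr fun i => ?_
    exact div_mul_eq_mul_div _ _ _ |>.trans (mul_div_assoc _ _ _)

lemma EdgeBound.tendsto_edgeInt_div_sq_mul_log [l.IsCountablyGenerated]
    (hb : EdgeBound h 2 C R) (hreg : RegularEndpoint h 2 A) (hε : Tendsto ε l (𝓝[>] 0))
    (hs : Tendsto s l (𝓝[Ioo 0 1] s₀)) (hc : Tendsto c l (𝓝 c₀)) (hc₀ : 0 < c₀) (hc₀R : c₀ < R) :
    Tendsto (fun i => edgeInt h (c i) (ε i) (s i) / (-ε i ^ 2 * Real.log (ε i))) l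
      (𝓝 (s₀ * (1 - s₀) / 2 * A)) := by
  have hs' : ∀ᶠ i in l, s i ∈ Ioo (0 : ℝ) 1 := hs.eventually self_mem_nhdsWithin
  have hsum := (hb.tendsto_setIntegral_Ioc_amgmGap (hc₀.trans hc₀R) hε hs').add
    (hb.tendsto_setIntegral_Ioc_amgmGap_of_pos hreg hε hs hc hc₀ hc₀R)
  rw [zero_add] at hsum
  refine hsum.congr' ?_
  filter_upwards [hs', hε.eventually self_mem_nhdsWithin, hc.eventually_lt_const hc₀R,
    (tendsto_nhds_of_tendsto_nhdsWithin hε).eventually_lt hc hc₀] with i hsi hεi hcR hεc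
  have hint := hb.integrableOn_amgmGap (Ioo_subset_Icc_self hsi) hεi hcR
  rw [← add_div, ← setIntegral_union (Ioc_disjoint_Ioc_of_le le_rfl) measurableSet_Ioc
    (hint.mono_set (Ioc_subset_Ioc_right hεc.le))
    (hint.mono_set (Ioc_subset_Ioc_left (le_of_lt hεi))),
    Ioc_union_Ioc_eq_Ioc (le_of_lt hεi) hεc.le, edgeInt]

end CriticalEdge

section EdgeLimit

variable {h : ℝ → ℝ} {κ A L R : ℝ}

/-- The contribution of one edge to the total defect has limit `c`, on the scale `w` of the shift
and jointly in the shift and the order. The support has length `L`, and its union with its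
translate by `ε` is cut in the middle. -/
def HasEdgeLimit (h : ℝ → ℝ) (L : ℝ) (w c : ℝ → ℝ) : Prop :=
  ∀ s₀, Tendsto (fun z : ℝ × ℝ => edgeInt h ((L + z.1) / 2) z.1 z.2 / w z.1)
    (𝓝[>] 0 ×ˢ 𝓝[Ioo 0 1] s₀) (𝓝 (c s₀))

lemma tendsto_add_div_two (L : ℝ) (l : Filter ℝ) :
    Tendsto (fun z : ℝ × ℝ => (L + z.1) / 2) (𝓝[>] 0 ×ˢ l) (𝓝 (L / 2)) := by
  simpa using ((tendsto_nhds_of_tendsto_nhdsWithin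
    (tendsto_fst (f := 𝓝[>] (0 : ℝ)) (g := l))).const_add L).div_const 2

namespace EdgeProfile

lemma hasEdgeLimit_rpow (hp : EdgeProfile h L) (hreg : RegularEndpoint h κ A) (hL : 0 < L)
    (hκ₀ : 0 < κ) (hκ₂ : κ < 2) : HasEdgeLimit h L (fun ε => ε ^ κ) fun s => A * edgeConst κ s := by
  obtain ⟨C, hb⟩ := hp.exists_edgeBound (R := 3 * L / 4) hreg (by linarith)
  exact fun s₀ => hb.tendsto_edgeInt_div_rpow hreg.tendsto_div_rpow hκ₀ hκ₂ tendsto_fst tendsto_snd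
    (tendsto_add_div_two L _) (by linarith) (by linarith)

lemma hasEdgeLimit_sq_mul_log (hp : EdgeProfile h L) (hreg : RegularEndpoint h 2 A) (hL : 0 < L) :
    HasEdgeLimit h L (fun ε => -ε ^ 2 * Real.log ε) fun s => s * (1 - s) / 2 * A := by
  obtain ⟨C, hb⟩ := hp.exists_edgeBound (R := 3 * L / 4) hreg (by linarith)
  exact fun s₀ => hb.tendsto_edgeInt_div_sq_mul_log hreg tendsto_fst tendsto_snd
    (tendsto_add_div_two L _) (by linarith) (by linarith)

lemma hasEdgeLimit_sq (hp : EdgeProfile h L) (hreg : RegularEndpoint h κ A) (hL : 0 < L)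
    (hκ : 2 < κ) : HasEdgeLimit h L (fun ε => ε ^ 2) fun s =>
      s * (1 - s) / 2 * ∫ u in Ioc 0 (L / 2), (h u)⁻¹ * deriv h u ^ 2 := by
  obtain ⟨C, hb⟩ := hp.exists_edgeBound (R := 3 * L / 4) hreg (by linarith)
  exact fun s₀ => hb.tendsto_edgeInt_div_sq hκ tendsto_fst tendsto_snd
    (tendsto_add_div_two L _) (by linarith)

lemma integrableOn_inv_mul_deriv_sq (hp : EdgeProfile h L) (hreg : RegularEndpoint h κ A)
    (hκ : 2 < κ) (hRL : R < L) : IntegrableOn (fun u => (h u)⁻¹ * deriv h u ^ 2) (Ioc 0 R) := by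
  obtain ⟨R', hRR', hR'L⟩ := exists_between hRL
  obtain ⟨C, hb⟩ := hp.exists_edgeBound hreg hR'L
  exact (hb.integrableOn_inv_mul_deriv_sq hκ).mono_set fun u hu => ⟨hu.1, hu.2.trans_lt hRR'⟩

end EdgeProfile

end EdgeLimit

section Reflection

variable {φ : ℝ → ℝ} {a b : ℝ}

lemma integrableOn_Ioo_of_halves (hab : a ≤ b)
    (hleft : IntegrableOn (fun u => φ (a + u)) (Ioc 0 ((b - a) / 2)))
    (hright : IntegrableOn (fun u => φ (b - u)) (Ioc 0 ((b - a) / 2))) :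
    IntegrableOn φ (Ioo a b) := by
  have hhalf : 0 ≤ (b - a) / 2 := by linarith
  have hleft' := ((intervalIntegrable_iff_integrableOn_Ioc_of_le hhalf).2 hleft).comp_sub_right a
  have hright' := ((intervalIntegrable_iff_integrableOn_Ioc_of_le hhalf).2 hright).comp_sub_left b
  simp only [add_sub_cancel, sub_sub_cancel, zero_add, sub_zero] at hleft' hright'
  rw [show (b - a) / 2 + a = b - (b - a) / 2 by ring] at hleft'
  exact (intervalIntegrable_iff_integrableOn_Ioo_of_le hab).1 (hleft'.trans hright'.symm)

lemma setIntegral_Ioc_eq_add_halves (hab : a ≤ b) (hφ : IntegrableOn φ (Ioc a b)) :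
    ∫ x in Ioc a b, φ x =
      (∫ u in Ioc 0 ((b - a) / 2), φ (a + u)) + ∫ u in Ioc 0 ((b - a) / 2), φ (b - u) := by
  have hmid : a + (b - a) / 2 = b - (b - a) / 2 := by ring
  have hmem : a + (b - a) / 2 ∈ Icc a b := ⟨by linarith, by linarith⟩
  have hφ' := (intervalIntegrable_iff_integrableOn_Ioc_of_le hab).2 hφ
  rw [← intervalIntegral.integral_of_le hab, ← intervalIntegral.integral_of_le (by linarith),
    ← intervalIntegral.integral_of_le (by linarith), intervalIntegral.integral_comp_add_left φ a,
    intervalIntegral.integral_comp_sub_left φ b, add_zero, sub_zero, ← hmid]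
  exact (intervalIntegral.integral_add_adjacent_intervals
    (hφ'.mono_set (uIcc_subset_uIcc_left (Icc_subset_uIcc hmem)))
    (hφ'.mono_set (uIcc_subset_uIcc_right (Icc_subset_uIcc hmem)))).symm

end Reflection

/-- `f` is a probability density on the line, positive exactly on `(a, b)` and of class `C¹`
there: the smoothness under which the limits are proved. -/
structure IsC1DensityOn (f : ℝ → ℝ) (a b : ℝ) : Prop where
  nonneg : ∀ x, 0 ≤ f x
  support_eq : Function.support f = Ioo a b
  contDiffOn : ContDiffOn ℝ 1 f (Ioo a b)
  integrable : Integrable f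
  integral_eq_one : ∫ x, f x = 1

lemma IsC3DensityOn.isC1DensityOn {f : ℝ → ℝ} {a b : ℝ} (hf : IsC3DensityOn f a b) :
    IsC1DensityOn f a b where
  nonneg := hf.nonneg
  support_eq := hf.support_eq
  contDiffOn := hf.contDiffOn.of_le (by norm_num)
  integrable := hf.integrable
  integral_eq_one := hf.integral_eq_one

namespace IsC1DensityOn

variable {f w c₁ c₂ G : ℝ → ℝ} {a b ε s x θ κ A₁ A₂ : ℝ}

protected lemma lt (hf : IsC1DensityOn f a b) : a < b := by
  by_contra hab
  have hzero : f = 0 := by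
    rw [← Function.support_eq_empty_iff, hf.support_eq, Ioo_eq_empty hab]
  simpa [hzero] using hf.integral_eq_one

protected lemma pos (hf : IsC1DensityOn f a b) (hx : x ∈ Ioo a b) : 0 < f x :=
  (hf.nonneg x).lt_of_ne' (Function.mem_support.1 (hf.support_eq ▸ hx))

lemma eq_zero (hf : IsC1DensityOn f a b) (hx : x ∉ Ioo a b) : f x = 0 :=
  Function.notMem_support.1 (hf.support_eq ▸ hx)

protected lemma measurable (hf : IsC1DensityOn f a b) : Measurable f := by
  have hf_eq : (Ioo a b).indicator f = f := by
    rw [← hf.support_eq, indicator_support]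
  classical
  rw [← hf_eq, ← piecewise_eq_indicator]
  exact hf.contDiffOn.continuousOn.measurable_piecewise continuousOn_const measurableSet_Ioo

lemma edgeProfile_left (hf : IsC1DensityOn f a b) : EdgeProfile (fun x => f (a + x)) (b - a) where
  measurable := hf.measurable.comp (measurable_const_add a)
  nonneg _ := hf.nonneg _
  eq_zero u hu := hf.eq_zero fun h => by linarith [h.1]
  pos u hu := hf.pos ⟨by linarith [hu.1], by linarith [hu.2]⟩
  contDiffOn := hf.contDiffOn.comp (by fun_prop)
    fun u hu => ⟨by linarith [hu.1], by linarith [hu.2]⟩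

lemma edgeProfile_right (hf : IsC1DensityOn f a b) : EdgeProfile (fun x => f (b - x)) (b - a) where
  measurable := hf.measurable.comp (measurable_const_sub b)
  nonneg _ := hf.nonneg _
  eq_zero u hu := hf.eq_zero fun h => by linarith [h.2]
  pos u hu := hf.pos ⟨by linarith [hu.2], by linarith [hu.1]⟩
  contDiffOn := hf.contDiffOn.comp (by fun_prop)
    fun u hu => ⟨by linarith [hu.2], by linarith [hu.1]⟩

lemma integrable_amgmGap (hf : IsC1DensityOn f a b) (hs : s ∈ Icc (0 : ℝ) 1) :
    Integrable fun x => amgmGap s (f x) (f (x - ε)) := by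
  refine (hf.integrable.add (hf.integrable.comp_sub_right ε)).mono' (measurable_amgmGap s
    hf.measurable (hf.measurable.comp (measurable_sub_const ε))).aestronglyMeasurable
    (.of_forall fun x => ?_)
  rw [Real.norm_of_nonneg (amgmGap_nonneg hs (hf.nonneg _) (hf.nonneg _))]
  exact amgmGap_le_add hs (hf.nonneg _) (hf.nonneg _)

lemma integral_amgmGap_eq (hf : IsC1DensityOn f a b) (hε : 0 < ε) (hs : s ∈ Ioo (0 : ℝ) 1) :
    ∫ x, amgmGap s (f x) (f (x - ε)) =
      edgeInt (fun x => f (a + x)) ((b - a + ε) / 2) ε s +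
        edgeInt (fun x => f (b - x)) ((b - a + ε) / 2) ε (1 - s) := by
  have hzero : ∀ x, x ∉ Ioc a (b + ε) → amgmGap s (f x) (f (x - ε)) = 0 := fun x hx => by
    rw [hf.eq_zero fun h => hx ⟨h.1, by linarith [h.2]⟩,
      hf.eq_zero fun h => hx ⟨by linarith [h.1], by linarith [h.2]⟩,
      amgmGap_zero_right hs.2.ne, mul_zero]
  have hreflect (u : ℝ) : amgmGap s (f (b + ε - u)) (f (b + ε - u - ε)) =
      amgmGap (1 - s) (f (b - u)) (f (b - (u - ε))) := by
    rw [amgmGap_one_sub_comm]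
    ring_nf
  rw [← setIntegral_eq_integral_of_forall_compl_eq_zero hzero,
    setIntegral_Ioc_eq_add_halves (by linarith [hf.lt])
      (hf.integrable_amgmGap (Ioo_subset_Icc_self hs)).integrableOn]
  simp only [hreflect]
  simp only [add_sub_right_comm b ε a, edgeInt, add_sub_assoc]

lemma relRenyi_locShift (hf : IsC1DensityOn f a b) (θ : ℝ) (hε : 0 < ε)
    (hs : s ∈ Ioo (0 : ℝ) 1) :
    relRenyi s (locShift f θ) (locShift f (θ + ε)) =
      -Real.log (1 - (edgeInt (fun x => f (a + x)) ((b - a + ε) / 2) ε s +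
        edgeInt (fun x => f (b - x)) ((b - a + ε) / 2) ε (1 - s))) := by
  have hint (t : ℝ) : ∫ x, locShift f t x = 1 :=
    (integral_sub_right_eq_self f t).trans hf.integral_eq_one
  have hshift : ∫ x, amgmGap s (locShift f θ x) (locShift f (θ + ε) x) =
      ∫ x, amgmGap s (f x) (f (x - ε)) := by
    simpa only [locShift, sub_sub] using
      integral_sub_right_eq_self (fun x => amgmGap s (f x) (f (x - ε))) θ
  rw [relRenyi_eq_neg_log_one_sub (p := locShift f θ) (q := locShift f (θ + ε))
    (Ioo_subset_Icc_self hs) (hf.integrable.comp_sub_right _) (hf.integrable.comp_sub_right _)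
    (fun _ => hf.nonneg _) (fun _ => hf.nonneg _) (hint _) (hint _), hshift,
    hf.integral_amgmGap_eq hε hs]

lemma tendstoUniformlyOn_relRenyi (hf : IsC1DensityOn f a b) (θ : ℝ)
    (hw : Tendsto w (𝓝[>] 0) (𝓝 0)) (hw₀ : ∀ᶠ ε in 𝓝[>] 0, w ε ≠ 0)
    (hleft : HasEdgeLimit (fun x => f (a + x)) (b - a) w c₁)
    (hright : HasEdgeLimit (fun x => f (b - x)) (b - a) w c₂)
    (hG : EqOn (fun s => c₁ s + c₂ (1 - s)) G (Ioo 0 1)) :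
    TendstoUniformlyOn (fun ε s => relRenyi s (locShift f θ) (locShift f (θ + ε)) / w ε) G
      (𝓝[>] 0) (Ioo 0 1) := by
  refine (tendstoUniformlyOn_of_isCompact_of_subset isCompact_Icc Ioo_subset_Icc_self
    fun s₀ _ => ?_).congr_right hG
  have hsnd : ∀ᶠ z : ℝ × ℝ in 𝓝[>] 0 ×ˢ 𝓝[Ioo 0 1] s₀, z.2 ∈ Ioo 0 1 :=
    tendsto_snd.eventually self_mem_nhdsWithin
  have hreflect : Tendsto (fun z : ℝ × ℝ => (z.1, 1 - z.2)) (𝓝[>] 0 ×ˢ 𝓝[Ioo 0 1] s₀)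
      (𝓝[>] 0 ×ˢ 𝓝[Ioo 0 1] (1 - s₀)) := by
    refine tendsto_fst.prodMk (tendsto_nhdsWithin_iff.2
      ⟨(tendsto_nhds_of_tendsto_nhdsWithin tendsto_snd).const_sub 1, ?_⟩)
    filter_upwards [hsnd] with z hz using ⟨sub_pos.2 hz.2, sub_lt_self 1 hz.1⟩
  have hsum := (hleft s₀).add ((hright (1 - s₀)).comp hreflect)
  simp only [Function.comp_apply, ← add_div] at hsum
  refine (tendsto_neg_log_one_sub_div hsum (hw.comp tendsto_fst)
    (tendsto_fst.eventually hw₀)).congr' ?_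
  filter_upwards [hsnd, tendsto_fst.eventually self_mem_nhdsWithin] with z hz hε
  rw [hf.relRenyi_locShift θ hε hz]

end IsC1DensityOn

namespace IsC1DensityOn

variable {f G : ℝ → ℝ} {a b θ κ A₁ A₂ : ℝ}

lemma regularEndpoint_left (hf : IsC1DensityOn f a b)
    (h : EndpointBehavior (fun x => f (a + x)) κ A₁) :
    RegularEndpoint (fun x => f (a + x)) κ A₁ :=
  h.regularEndpoint (hf.edgeProfile_left.eventually_ne_zero (sub_pos.2 hf.lt))

lemma regularEndpoint_right (hf : IsC1DensityOn f a b)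
    (h : EndpointBehavior (fun x => f (b - x)) κ A₂) :
    RegularEndpoint (fun x => f (b - x)) κ A₂ :=
  h.regularEndpoint (hf.edgeProfile_right.eventually_ne_zero (sub_pos.2 hf.lt))

lemma tendstoUniformlyOn_relRenyi_div_rpow (hf : IsC1DensityOn f a b)
    (h₁ : RegularEndpoint (fun x => f (a + x)) κ A₁)
    (h₂ : RegularEndpoint (fun x => f (b - x)) κ A₂) (hκ₀ : 0 < κ) (hκ₂ : κ < 2)
    (hG : EqOn (fun s => A₁ * edgeConst κ s + A₂ * edgeConst κ (1 - s)) G (Ioo 0 1)) :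
    TendstoUniformlyOn (fun ε s => relRenyi s (locShift f θ) (locShift f (θ + ε)) / ε ^ κ) G
      (𝓝[>] 0) (Ioo 0 1) := by
  have hL : 0 < b - a := sub_pos.2 hf.lt
  have hpow := tendsto_nhdsWithin_iff.1 (tendsto_rpow_nhdsGT_zero hκ₀)
  exact hf.tendstoUniformlyOn_relRenyi θ hpow.1 (hpow.2.mono fun _ h => ne_of_gt h)
    (hf.edgeProfile_left.hasEdgeLimit_rpow h₁ hL hκ₀ hκ₂)
    (hf.edgeProfile_right.hasEdgeLimit_rpow h₂ hL hκ₀ hκ₂) hG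

lemma tendstoUniformlyOn_relRenyi_div_sq_mul_log (hf : IsC1DensityOn f a b)
    (h₁ : RegularEndpoint (fun x => f (a + x)) 2 A₁)
    (h₂ : RegularEndpoint (fun x => f (b - x)) 2 A₂) :
    TendstoUniformlyOn
      (fun ε s => relRenyi s (locShift f θ) (locShift f (θ + ε)) / (-ε ^ 2 * Real.log ε))
      (fun s => (A₁ + A₂) * s * (1 - s) / 2) (𝓝[>] 0) (Ioo 0 1) := by
  have hL : 0 < b - a := sub_pos.2 hf.lt
  have hscale : Tendsto (fun ε : ℝ => -ε ^ 2 * Real.log ε) (𝓝[>] 0) (𝓝 0) := by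
    simpa [mul_comm] using (tendsto_log_mul_rpow_nhdsGT_zero two_pos).neg
  refine hf.tendstoUniformlyOn_relRenyi θ hscale ?_
    (hf.edgeProfile_left.hasEdgeLimit_sq_mul_log h₁ hL)
    (hf.edgeProfile_right.hasEdgeLimit_sq_mul_log h₂ hL) fun s _ => by ring
  filter_upwards [Ioo_mem_nhdsGT one_pos] with ε hε
  exact mul_ne_zero (neg_ne_zero.2 (pow_ne_zero 2 hε.1.ne')) (Real.log_neg hε.1 hε.2).ne

lemma integrableOn_fisher (hf : IsC1DensityOn f a b)
    (h₁ : RegularEndpoint (fun x => f (a + x)) κ A₁)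
    (h₂ : RegularEndpoint (fun x => f (b - x)) κ A₂) (hκ : 2 < κ) :
    IntegrableOn (fun x => (f x)⁻¹ * deriv f x ^ 2) (Ioo a b) := by
  have hhalf : (b - a) / 2 < b - a := half_lt_self (sub_pos.2 hf.lt)
  refine integrableOn_Ioo_of_halves hf.lt.le ?_ ?_
  · simpa only [deriv_comp_const_add] using
      hf.edgeProfile_left.integrableOn_inv_mul_deriv_sq h₁ hκ hhalf
  · simpa only [deriv_comp_const_sub, neg_sq] using
      hf.edgeProfile_right.integrableOn_inv_mul_deriv_sq h₂ hκ hhalf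

lemma tendstoUniformlyOn_relRenyi_div_sq (hf : IsC1DensityOn f a b)
    (h₁ : RegularEndpoint (fun x => f (a + x)) κ A₁)
    (h₂ : RegularEndpoint (fun x => f (b - x)) κ A₂) (hκ : 2 < κ) :
    TendstoUniformlyOn (fun ε s => relRenyi s (locShift f θ) (locShift f (θ + ε)) / ε ^ 2)
      (fun s => s * (1 - s) / 2 * fisherIntegral f a b) (𝓝[>] 0) (Ioo 0 1) := by
  have hL : 0 < b - a := sub_pos.2 hf.lt
  have hpow := tendsto_nhdsWithin_iff.1 (tendsto_rpow_nhdsGT_zero two_pos)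
  simp only [Real.rpow_two] at hpow
  refine hf.tendstoUniformlyOn_relRenyi θ hpow.1 (hpow.2.mono fun _ h => ne_of_gt h)
    (hf.edgeProfile_left.hasEdgeLimit_sq h₁ hL hκ)
    (hf.edgeProfile_right.hasEdgeLimit_sq h₂ hL hκ) fun s _ => ?_
  have hint := (integrableOn_Ioc_iff_integrableOn_Ioo enorm_ne_top).2
    (hf.integrableOn_fisher h₁ h₂ hκ)
  simp only [fisherIntegral, ← integral_Ioc_eq_integral_Ioo,
    setIntegral_Ioc_eq_add_halves hf.lt.le hint, deriv_comp_const_add, deriv_comp_const_sub, neg_sq]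
  ring

end IsC1DensityOn

theorem theorem1_general (f : ℝ → ℝ) (a b κ A₁ A₂ θ : ℝ)
    (hf : IsC1DensityOn f a b)
    (h₁ : RegularEndpoint (fun x => f (a + x)) κ A₁)
    (h₂ : RegularEndpoint (fun x => f (b - x)) κ A₂) :
    RenyiLimits f a b κ A₁ A₂ θ := by
  have hrefl {s : ℝ} (hs : s ∈ Ioo (0 : ℝ) 1) : 1 - s ∈ Ioo (0 : ℝ) 1 :=
    ⟨sub_pos.2 hs.2, sub_lt_self 1 hs.1⟩
  refine ⟨fun hκ₀ hκ₁ => ?_, fun hκ => ?_, fun hκ₁ hκ₂ => ?_, fun hκ => ?_, fun hκ =>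
    ⟨hf.integrableOn_fisher h₁ h₂ hκ, hf.tendstoUniformlyOn_relRenyi_div_sq h₁ h₂ hκ⟩⟩
  · refine hf.tendstoUniformlyOn_relRenyi_div_rpow h₁ h₂ hκ₀ (by linarith) fun s hs => ?_
    simp only [edgeConst_eq_of_lt_one hκ₀ hκ₁ hs, edgeConst_eq_of_lt_one hκ₀ hκ₁ (hrefl hs),
      sub_sub_cancel]
    ring
  · subst hκ
    refine hf.tendstoUniformlyOn_relRenyi_div_rpow h₁ h₂ one_pos one_lt_two fun s hs => ?_
    simp only [edgeConst_one hs, edgeConst_one (hrefl hs)]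
  · have hκ₀ : 0 < κ := one_pos.trans hκ₁
    refine hf.tendstoUniformlyOn_relRenyi_div_rpow h₁ h₂ hκ₀ hκ₂ fun s hs => ?_
    simp only [edgeConst_eq hκ₀ hκ₂ hs, edgeConst_eq hκ₀ hκ₂ (hrefl hs), sub_sub_cancel]
    ring
  · subst hκ
    exact hf.tendstoUniformlyOn_relRenyi_div_sq_mul_log h₁ h₂

theorem theorem1 (f : ℝ → ℝ) (a b κ₁ κ₂ A₁ A₂ θ : ℝ)
    (hf : IsC3DensityOn f a b)
    (h₁ : EndpointBehavior (fun x => f (a + x)) κ₁ A₁)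
    (h₂ : EndpointBehavior (fun x => f (b - x)) κ₂ A₂) :
    (κ₁ = κ₂ → RenyiLimits f a b κ₁ A₁ A₂ θ) ∧
    (κ₁ < κ₂ → RenyiLimits f a b κ₁ A₁ 0 θ) := by
  have hf' := hf.isC1DensityOn
  have hreg₁ := hf'.regularEndpoint_left h₁
  have hreg₂ := hf'.regularEndpoint_right h₂
  exact ⟨fun hκ => theorem1_general f a b κ₁ A₁ A₂ θ hf' hreg₁ (hκ ▸ hreg₂),
    fun hκ => theorem1_general f a b κ₁ A₁ 0 θ hf' hreg₁ (hreg₂.of_lt hκ)⟩
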